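/- Let $(\mathcal C,\otimes,I,C)$ be a braided tensor category, $\mathcal D$ a tensor category containing $\mathcal C$ through a faithful strong tensor functor $\mathcal C\to\mathcal D$ (suppressed from the notation). Let $H$ and $H^d$ be Hopf algebras in $\mathcal C$ with invertible antipodes such that the braiding is symmetric on them: $C_{U,V}=C_{V,U}^{-1}$ for $U,V\in\{H,H^d\}$. Let $H^d$ be a quasi-dual of $H$ under a morphism $\langle\,,\rangle:H^d\otimes H\to I$ of $\mathcal C$; that is, with $\langle\,,\rangle_2=(\langle\,,\rangle\otimes\langle\,,\rangle)(H^d\otimes C_{H^d,H}\otimes H)$, $$\langle\,,\rangle(H^d\otimes m_H)=\langle\,,\rangle_2(\Delta_{H^d}\otimes H\otimes H),\quad \langle\,,\rangle(m_{H^d}\otimes H)=\langle\,,\rangle_2(H^d\otimes H^d\otimes\Delta_H),$$ $$\langle\,,\rangle(H^d\otimes\eta_H)=\epsilon_{H^d},\quad \langle\,,\rangle(\eta_{H^d}\otimes H)=\epsilon_H,\quad \langle\,,\rangle(S_{H^d}\otimes H)=\langle\,,\rangle(H^d\otimes S_H).$$ For a bialgebra $B$ in $\mathcal C$ and a left $B$-module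 algebra $(A,\alpha)$, the smash product $A\#B$ is $A\otimes B$ with unit $\eta_A\otimes\eta_B$ and multiplication $(m_A\otimes m_B)(A\otimes\alpha\otimes B\otimes B)(A\otimes B\otimes C_{B,A}\otimes B)(A\otimes\Delta_B\otimes A\otimes B)$. The Hopf algebra $H^d$ acts on $H$ by $\rightharpoonup\,=(H\otimes\langle\,,\rangle)(C_{H^d,H}\otimes H)(H^d\otimes\Delta)$, which gives $H\#H^d$; the notation $H^d\#H$ below only refers to the object $H^d\otimes H$. Assume the CRL-condition relative to $\mathcal D$: 1. There are an algebra $E$ in $\mathcal C$ (playing the role of $\mathrm{End}_{\mathcal D}H$) and a morphism $val:E\otimes H\to H$ in $\mathcal D$ such that the multiplication of $E$ is composition, i.e. $val(m_E\otimes H)=val(E\otimes val)$ and $val(\eta_E\otimes H)=\mathrm{id}_H$, and such that for all objects $U$ of $\mathcal C$ and all morphisms $f,g:U\to E$ in $\mathcal D$, $val(f\otimes H)=val(g\otimes H)$ implies $f=g$. 2. There are morphisms $\lambda:H\#H^d\to E$ and $\rho:H^d\#H\to E$ in $\mathcal D$ with $val(\lambda\otimes H)=(m\otimes\langle\,,\rangle)(H\otimes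 C_{H^d,H}\otimes H)(H\otimes H^d\otimes\Delta)$ and $val(\rho\otimes H)=m(\langle\,,\rangle\otimes C_{H,H})(H^d\otimes C_{H,H}\otimes H)(H^d\otimes H\otimes\Delta)$. 3. $\lambda$ has an image $\mathrm{Im}\,\lambda$ in $\mathcal D$ (a smallest subobject of $E$ through which $\lambda$ factors), there is a morphism $\bar\lambda:\mathrm{Im}\,\lambda\to H\#H^d$ in $\mathcal D$ with $\bar\lambda\lambda=\mathrm{id}_{H\#H^d}$, and $\rho(\mathrm{id}_{H^d}\otimes\eta_H):H^d\to E$ factors through $\mathrm{Im}\,\lambda$, so that $\bar\lambda\rho(\mathrm{id}_{H^d}\otimes\eta_H):H^d\to H\#H^d$ is defined. 4. $C_{E,V}(\lambda\otimes V)=(V\otimes\lambda)C_{H\#H^d,V}$ and $C_{E,V}(\rho\otimes V)=(V\otimes\rho)C_{H^d\#H,V}$ for every object $V$ of $\mathcal C$. Let $(R,\psi)$ be a right $H^d$-comodule algebra in $\mathcal C$ (so $\psi:R\to R\otimes H^d$ is a coaction and a morphism of algebras into the braided tensor product algebra), and suppose that $R\otimes\mathrm{Im}\,\lambda\to R\otimes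 E$ is still a monomorphism in $\mathcal D$ (this is automatic if tensoring in $\mathcal D$ preserves monomorphisms, e.g. for vector spaces). Then $H$ is an $H^d$-module algebra under $\rightharpoonup$; $R$ is an $H$-module algebra under $(R\otimes\langle\,,\rangle)(R\otimes C_{H,H^d})(C_{H,R}\otimes H^d)(H\otimes\psi)$; $R\#H$ is an $H^d$-module algebra under $(R\otimes\rightharpoonup)(C_{H^d,R}\otimes H)$; the smash products $H\#H^d$ and $(R\#H)\#H^d$ are algebras in $\mathcal C$; and there is an isomorphism $$(R\#H)\#H^d\;\cong\;R\otimes(H\#H^d)$$ of algebras in $\mathcal D$, where the right-hand side is the braided tensor product of algebras in $\mathcal C$. If moreover $\bar\lambda\rho(\mathrm{id}_{H^d}\otimes\eta_H)$ is a morphism in $\mathcal C$, then this same isomorphism is an isomorphism of algebras in $\mathcal C$. -/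

import Mathlib

open CategoryTheory MonoidalCategory
open scoped MonObj ComonObj HopfObj

universe v u v' u'

namespace BraidedDuality

section Braided

variable {C : Type u} [Category.{v} C] [MonoidalCategory C] [BraidedCategory C]

/-- `(X, e, m)` is a unital associative algebra in `C`. -/
structure IsAlgebra {X : C} (e : 𝟙_ C ⟶ X) (m : X ⊗ X ⟶ X) : Prop where
  one_mul : e ▷ X ≫ m = (λ_ X).hom
  mul_one : X ◁ e ≫ m = (ρ_ X).hom
  mul_assoc : m ▷ X ≫ m = (α_ X X X).hom ≫ X ◁ m ≫ m

/-- The bundled algebra `(X, e, m)`. -/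
def IsAlgebra.toMon {X : C} {e : 𝟙_ C ⟶ X} {m : X ⊗ X ⟶ X} (h : IsAlgebra e m) : Mon C where
  X := X
  mon :=
    { one := e
      mul := m
      one_mul := h.one_mul
      mul_one := h.mul_one
      mul_assoc := h.mul_assoc }

/-- `(A, e, m)` is a left `B`-module algebra under `act : B ⊗ A ⟶ A`: `act` is a left action of
the algebra `B`, and `m` and `e` are `B`-linear, i.e. `b·(xy) = (b₁·x)(b₂·y)` (with `b₂` moved past
`x` by the braiding) and `b·1 = ε(b)1`. -/
structure IsModuleAlgebra (B : C) [BimonObj B] {A : C} (e : 𝟙_ C ⟶ A) (m : A ⊗ A ⟶ A)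
    (act : B ⊗ A ⟶ A) : Prop where
  isAlgebra : IsAlgebra e m
  one_act : η[B] ▷ A ≫ act = (λ_ A).hom
  mul_act : μ[B] ▷ A ≫ act = (α_ B B A).hom ≫ B ◁ act ≫ act
  act_one : B ◁ e ≫ act = (ρ_ B).hom ≫ ε[B] ≫ e
  act_mul : B ◁ m ≫ act = Δ[B] ▷ (A ⊗ A) ≫ tensorμ B B A A ≫ (act ⊗ₘ act) ≫ m

/-- `b ⊗ x ↦ b₁·x ⊗ b₂`, the map `B ⊗ A ⟶ A ⊗ B` that commutes `B` past `A` in the smash product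
`A # B`. -/
def smashTwist (B : C) [BimonObj B] {A : C} (act : B ⊗ A ⟶ A) : B ⊗ A ⟶ A ⊗ B :=
  Δ[B] ▷ A ≫ (α_ B B A).hom ≫ B ◁ (β_ B A).hom ≫ (α_ B A B).inv ≫ act ▷ B

/-- The unit of the smash product `A # B`, whose underlying object is `A ⊗ B`. -/
def smashOne (B : C) [BimonObj B] {A : C} (e : 𝟙_ C ⟶ A) : 𝟙_ C ⟶ A ⊗ B :=
  (λ_ (𝟙_ C)).inv ≫ (e ⊗ₘ η[B])

/-- The multiplication `(x # b)(y # b') = x (b₁·y) # b₂ b'` of the smash product `A # B`. -/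
def smashMul (B : C) [BimonObj B] {A : C} (m : A ⊗ A ⟶ A) (act : B ⊗ A ⟶ A) :
    (A ⊗ B) ⊗ (A ⊗ B) ⟶ A ⊗ B :=
  (α_ A B (A ⊗ B)).hom ≫ A ◁ (α_ B A B).inv ≫ A ◁ (smashTwist B act ▷ B) ≫
    A ◁ (α_ A B B).hom ≫ (α_ A A (B ⊗ B)).inv ≫ (m ⊗ₘ μ[B])

/-- The braiding is symmetric on `H` and `K`: `C_{U,V} = C_{V,U}⁻¹` for all `U, V ∈ {H, K}`. -/
structure IsSymmetricOn (H K : C) : Prop where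
  left_left : (β_ H H).hom = (β_ H H).inv
  left_right : (β_ H K).hom = (β_ K H).inv
  right_left : (β_ K H).hom = (β_ H K).inv
  right_right : (β_ K K).hom = (β_ K K).inv

/-- The extension `f ⊗ g ⊗ x ⊗ y ↦ ⟨f, x⟩⟨g, y⟩` of a pairing, where `g` and `x` are interchanged by
the braiding first. -/
def pairing₂ {H K : C} (ev : K ⊗ H ⟶ 𝟙_ C) : (K ⊗ K) ⊗ (H ⊗ H) ⟶ 𝟙_ C :=
  tensorμ K K H H ≫ (ev ⊗ₘ ev) ≫ (λ_ (𝟙_ C)).hom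

/-- The braided Hopf algebra `K` is a quasi-dual of the braided Hopf algebra `H` under the pairing
`ev = ⟨ , ⟩ : K ⊗ H ⟶ I`. -/
structure IsQuasiDual (H K : C) [HopfObj H] [HopfObj K] (ev : K ⊗ H ⟶ 𝟙_ C) : Prop where
  pair_mul : K ◁ μ[H] ≫ ev = Δ[K] ▷ (H ⊗ H) ≫ pairing₂ ev
  pair_one : K ◁ η[H] ≫ ev = (ρ_ K).hom ≫ ε[K]
  mul_pair : μ[K] ▷ H ≫ ev = (K ⊗ K) ◁ Δ[H] ≫ pairing₂ ev
  one_pair : η[K] ▷ H ≫ ev = (λ_ H).hom ≫ ε[H]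
  antipode_pair : 𝒮[K] ▷ H ≫ ev = K ◁ 𝒮[H] ≫ ev

/-- `(R, ψ)` is a right `K`-comodule algebra: `ψ : R ⟶ R ⊗ K` is a right coaction and a morphism of
algebras into the braided tensor product algebra `R ⊗ K`. -/
structure IsComoduleAlgebra (K : C) [BimonObj K] {R : C} [MonObj R] (ψ : R ⟶ R ⊗ K) : Prop where
  counit : ψ ≫ R ◁ ε[K] = (ρ_ R).inv
  coassoc : ψ ≫ ψ ▷ K ≫ (α_ R K K).hom = ψ ≫ R ◁ Δ[K]
  isMonHom : IsMonHom ψ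

section Actions

variable (H K : C) [HopfObj H] [HopfObj K] (ev : K ⊗ H ⟶ 𝟙_ C)

/-- The action `⇀` of `K` on `H`: `f ⇀ x = x₁⟨f, x₂⟩`, i.e.
`(H ⊗ ⟨ , ⟩)(C_{K,H} ⊗ H)(K ⊗ Δ)`. -/
def hit : K ⊗ H ⟶ H :=
  K ◁ Δ[H] ≫ (α_ K H H).inv ≫ (β_ K H).hom ▷ H ≫ (α_ H K H).hom ≫ H ◁ ev ≫ (ρ_ H).hom

/-- The action of `K` on `R ⊗ H` that is trivial on `R` and `⇀` on `H`, i.e.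
`(R ⊗ ⇀)(C_{K,R} ⊗ H)`. -/
def hitRight (R : C) : K ⊗ (R ⊗ H) ⟶ R ⊗ H :=
  (α_ K R H).inv ≫ (β_ K R).hom ▷ H ≫ (α_ R K H).hom ≫ R ◁ hit H K ev

/-- The action of `H` on a right `K`-comodule `R` induced by the pairing: `h·r = r₀⟨r₁, h⟩`, i.e.
`(R ⊗ ⟨ , ⟩)(R ⊗ C_{H,K})(C_{H,R} ⊗ K)(H ⊗ ψ)`. -/
def coactionAct {R : C} (ψ : R ⟶ R ⊗ K) : H ⊗ R ⟶ R :=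
  H ◁ ψ ≫ (α_ H R K).inv ≫ (β_ H R).hom ▷ K ≫ (α_ R H K).hom ≫ R ◁ (β_ H K).hom ≫
    R ◁ ev ≫ (ρ_ R).hom

/-- The left action of `H # K` on `H` defining `λ`: `(h # f) ⊗ x ↦ h (f ⇀ x) = h x₁⟨f, x₂⟩`, i.e.
`(m ⊗ ⟨ , ⟩)(H ⊗ C_{K,H} ⊗ H)(H ⊗ K ⊗ Δ)`. -/
def lamAct : (H ⊗ K) ⊗ H ⟶ H :=
  (H ⊗ K) ◁ Δ[H] ≫ tensorμ H K H H ≫ (μ[H] ⊗ₘ ev) ≫ (ρ_ H).hom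

/-- The right action of `K # H` on `H` defining `ρ`: `(f # h) ⊗ x ↦ ⟨f, x₁⟩ x₂ h`, i.e.
`m (⟨ , ⟩ ⊗ C_{H,H})(K ⊗ C_{H,H} ⊗ H)(K ⊗ H ⊗ Δ)`. -/
def rhoAct : (K ⊗ H) ⊗ H ⟶ H :=
  (K ⊗ H) ◁ Δ[H] ≫ tensorμ K H H H ≫ (ev ⊗ₘ (β_ H H).hom) ≫ (λ_ (H ⊗ H)).hom ≫ μ[H]

/-- The multiplication of the smash product `H # K` for the action `⇀`. -/
abbrev smashMulHK : (H ⊗ K) ⊗ (H ⊗ K) ⟶ H ⊗ K :=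
  smashMul K μ[H] (hit H K ev)

/-- The multiplication of the smash product `R # H` for the action induced by the coaction `ψ`. -/
abbrev smashMulRH {R : C} [MonObj R] (ψ : R ⟶ R ⊗ K) : (R ⊗ H) ⊗ (R ⊗ H) ⟶ R ⊗ H :=
  smashMul H μ[R] (coactionAct H K ev ψ)

/-- The multiplication of the iterated smash product `(R # H) # K`. -/
abbrev smashMulRHK {R : C} [MonObj R] (ψ : R ⟶ R ⊗ K) :
    ((R ⊗ H) ⊗ K) ⊗ ((R ⊗ H) ⊗ K) ⟶ (R ⊗ H) ⊗ K :=
  smashMul K (smashMulRH H K ev ψ) (hitRight H K ev R)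

end Actions

/-- The CRL-condition on `H` and `K = H^d` under `ev`, relative to an ambient monoidal category `D`
containing `C` through the monoidal functor `F`.

* `E` is an algebra in `C` which stands for `End_D H`: the evaluation `val` lives in `D`, it turns
  the unit and the product of `E` into the identity and the composition of endomorphisms of `H`, and
  a morphism of `D` from an object of `C` to `E` is determined by what it does to `H`.
* `lam` and `rho` are the morphisms `λ` and `ρ` in `D`, with the prescribed actions on `H`.
* `img` is the image of `λ` in `D` (the smallest subobject of `E` through which `λ` factors), with
  corestriction `img.F.e` and inclusion `img.F.m`; `lamBar` is `λ̄ : Im λ ⟶ H # K` with `λ̄ λ = id`.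
* `rhoFac` is `ρ(id ⊗ η) : K ⟶ E`, regarded as a morphism to `Im λ`, so that `λ̄ ρ(id ⊗ η)` makes
  sense.
* the last two fields say that the braiding of `C` is natural with respect to `λ` and `ρ`. -/
structure CRL {D : Type u'} [Category.{v'} D] [MonoidalCategory D] (F : C ⥤ D) [F.Monoidal]
    (H K : C) [HopfObj H] [HopfObj K] (ev : K ⊗ H ⟶ 𝟙_ C) where
  E : C
  [algE : MonObj E]
  val : F.obj E ⊗ F.obj H ⟶ F.obj H
  val_one : (Functor.LaxMonoidal.ε F ≫ F.map η[E]) ▷ F.obj H ≫ val = (λ_ (F.obj H)).hom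
  val_mul : (Functor.LaxMonoidal.μ F E E ≫ F.map μ[E]) ▷ F.obj H ≫ val =
    (α_ (F.obj E) (F.obj E) (F.obj H)).hom ≫ F.obj E ◁ val ≫ val
  val_injective : ∀ {U : C} (f g : F.obj U ⟶ F.obj E),
    f ▷ F.obj H ≫ val = g ▷ F.obj H ≫ val → f = g
  lam : F.obj (H ⊗ K) ⟶ F.obj E
  rho : F.obj (K ⊗ H) ⟶ F.obj E
  lam_val : lam ▷ F.obj H ≫ val =
    Functor.LaxMonoidal.μ F (H ⊗ K) H ≫ F.map (lamAct H K ev)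
  rho_val : rho ▷ F.obj H ≫ val =
    Functor.LaxMonoidal.μ F (K ⊗ H) H ≫ F.map (rhoAct H K ev)
  img : Limits.ImageFactorisation lam
  lamBar : img.F.I ⟶ F.obj (H ⊗ K)
  lamBar_lam : img.F.e ≫ lamBar = 𝟙 (F.obj (H ⊗ K))
  rhoFac : F.obj K ⟶ img.F.I
  rhoFac_fac : rhoFac ≫ img.F.m = F.map ((ρ_ K).inv ≫ K ◁ η[H]) ≫ rho
  lam_braiding : ∀ V : C,
    lam ▷ F.obj V ≫ Functor.LaxMonoidal.μ F E V ≫ F.map (β_ E V).hom =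
      Functor.LaxMonoidal.μ F (H ⊗ K) V ≫ F.map (β_ (H ⊗ K) V).hom ≫
        Functor.OplaxMonoidal.δ F V (H ⊗ K) ≫ F.obj V ◁ lam ≫ Functor.LaxMonoidal.μ F V E
  rho_braiding : ∀ V : C,
    rho ▷ F.obj V ≫ Functor.LaxMonoidal.μ F E V ≫ F.map (β_ E V).hom =
      Functor.LaxMonoidal.μ F (K ⊗ H) V ≫ F.map (β_ (K ⊗ H) V).hom ≫
        Functor.OplaxMonoidal.δ F V (K ⊗ H) ≫ F.obj V ◁ rho ≫ Functor.LaxMonoidal.μ F V E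

/-- The morphism `λ̄ ρ(id ⊗ η) : K ⟶ H # K` in `D`. -/
def CRL.lamBarRho {D : Type u'} [Category.{v'} D] [MonoidalCategory D] {F : C ⥤ D} [F.Monoidal]
    {H K : C} [HopfObj H] [HopfObj K] {ev : K ⊗ H ⟶ 𝟙_ C} (c : CRL F H K ev) :
    F.obj K ⟶ F.obj (H ⊗ K) :=
  c.rhoFac ≫ c.lamBar

end Braided

end BraidedDuality

/-!
Write `B = H # K`, with `K = H^d`. The iterated smash product `(R # H) # K` is, up to reassociation,
the tensor product `R ⊗ B` in which `b` is moved past `r` by a twist `T` instead of the braiding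
(`smashMulRHK_eq`). This twist involves `R` only through its coaction: `T(b ⊗ r) = r₀ ⊗ q(b, r₁)`,
up to braidings, where `q : B ⊗ K ⟶ B` lets `K` act on the tensor factor `H` of `B` by
`(f, x) ↦ ⟨f, x₁⟩x₂` (`op22_iterTwist`).

The CRL-condition makes `q` inner. As `λ` is a monomorphism, `B` acts faithfully on `H`, and
`κ = λ̄ ρ(id ⊗ η) : K ⟶ B` is the morphism through which `K` acts on `H` by `(f, x) ↦ ⟨f, x₁⟩x₂`.
Every identity involving `κ` may therefore be checked on `H`, where it follows from quasi-duality: `κ`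
is unital and antimultiplicative, and `q(b, f₁) κ(f₂) = κ(f) b` (`CRL.innerTwist`). Given these
identities,

  `r ⊗ b ↦ r₀ ⊗ κ(r₁) b`

is multiplicative from the braided tensor product algebra `R ⊗ B` to the one twisted by `T`
(`InnerTwist.map_mul`). It is invertible, the inverse being given by `κ S⁻¹` instead of `κ`, since
`κ` is antimultiplicative (`InnerTwist.op_map_inv`, `InnerTwist.op_inv_map`). If `κ` is a morphism
of `C`, then so are this map and its inverse.

That the three actions are module algebra structures is one statement, applied three times: a right
comodule algebra over `H` is a left module algebra over a quasi-dual of `H`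
(`coact_isModuleAlgebra`).

Computations are done on right-nested tensor products with an arbitrary last factor, so that no
associators occur. Identities between morphisms of `D` are computed in the category `FullImage F`,
which has the objects and the tensor product of `C` and the morphisms of `D`; there the braiding of
`C` is natural only for some morphisms, `κ` among them by the CRL-condition.
-/

namespace BraidedDuality

/-! ### Words of morphisms -/

section Strings

variable {C : Type u} [Category.{v} C] [MonoidalCategory C]

/-- `f : X ⊗ Y ⟶ W` applied to the first strands of a right-nested tensor product with tail `Z`.

The definitions `opmn` do this for a morphism with `m` input and `n` output strands. A composite of
morphisms `V ◁ opmn f Z`, a *word*, mentions no associators, and equalities of words can be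
rewritten with one another. Since the tail `Z` is arbitrary, a family of words determines a
morphism, by `ext_whiskerRight`. -/
def op21 {X Y W : C} (f : X ⊗ Y ⟶ W) (Z : C) : X ⊗ (Y ⊗ Z) ⟶ W ⊗ Z :=
  (α_ X Y Z).inv ≫ f ▷ Z

/-- `f`, from one strand to two strands, applied in front of the tail `Z`. -/
def op12 {X Y W : C} (f : X ⟶ Y ⊗ W) (Z : C) : X ⊗ Z ⟶ Y ⊗ (W ⊗ Z) :=
  f ▷ Z ≫ (α_ Y W Z).hom

/-- `f`, from two strands to two strands, applied in front of the tail `Z`. -/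
def op22 {X Y V W : C} (f : X ⊗ Y ⟶ V ⊗ W) (Z : C) : X ⊗ (Y ⊗ Z) ⟶ V ⊗ (W ⊗ Z) :=
  (α_ X Y Z).inv ≫ f ▷ Z ≫ (α_ V W Z).hom

/-- `f`, from two strands to no strands, applied in front of the tail `Z`. -/
def op20 {X Y : C} (f : X ⊗ Y ⟶ 𝟙_ C) (Z : C) : X ⊗ (Y ⊗ Z) ⟶ Z :=
  (α_ X Y Z).inv ≫ f ▷ Z ≫ (λ_ Z).hom

/-- `f`, from one strand to no strands, applied in front of the tail `Z`. -/
def op10 {X : C} (f : X ⟶ 𝟙_ C) (Z : C) : X ⊗ Z ⟶ Z :=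
  f ▷ Z ≫ (λ_ Z).hom

/-- `f`, from no strands to one strand, applied in front of the tail `Z`. -/
def op01 {X : C} (f : 𝟙_ C ⟶ X) (Z : C) : Z ⟶ X ⊗ Z :=
  (λ_ Z).inv ≫ f ▷ Z

/-- The lemmas `natmn` interchange `f`, acting on the leading strands, with a morphism `g` of the
tail. -/
theorem nat11 {X W : C} (f : X ⟶ W) {Z Z' : C} (g : Z ⟶ Z') :
    X ◁ g ≫ f ▷ Z' = f ▷ Z ≫ W ◁ g := whisker_exchange _ _

theorem nat21 {X Y W : C} (f : X ⊗ Y ⟶ W) {Z Z' : C} (g : Z ⟶ Z') :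
    X ◁ Y ◁ g ≫ op21 f Z' = op21 f Z ≫ W ◁ g := by
  simp only [op21, associator_inv_naturality_right_assoc, whisker_exchange, Category.assoc]

theorem nat12 {X Y W : C} (f : X ⟶ Y ⊗ W) {Z Z' : C} (g : Z ⟶ Z') :
    X ◁ g ≫ op12 f Z' = op12 f Z ≫ Y ◁ W ◁ g := by
  simp only [op12, whisker_exchange_assoc, Category.assoc, associator_naturality_right]

theorem nat22 {X Y V W : C} (f : X ⊗ Y ⟶ V ⊗ W) {Z Z' : C} (g : Z ⟶ Z') :
    X ◁ Y ◁ g ≫ op22 f Z' = op22 f Z ≫ V ◁ W ◁ g := by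
  simp only [op22, associator_inv_naturality_right_assoc, whisker_exchange_assoc, Category.assoc,
    associator_naturality_right]

theorem nat20 {X Y : C} (f : X ⊗ Y ⟶ 𝟙_ C) {Z Z' : C} (g : Z ⟶ Z') :
    X ◁ Y ◁ g ≫ op20 f Z' = op20 f Z ≫ g := by
  simp only [op20, associator_inv_naturality_right_assoc, whisker_exchange_assoc, Category.assoc,
    leftUnitor_naturality]

theorem nat01 {X : C} (f : 𝟙_ C ⟶ X) {Z Z' : C} (g : Z ⟶ Z') :
    g ≫ op01 f Z' = op01 f Z ≫ X ◁ g := by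
  simp only [op01, leftUnitor_inv_naturality_assoc, whisker_exchange, Category.assoc]

/-- The lemmas `whiskermn` whisker an equality between words of length `m` and `n` on the left;
length `0` stands for the identity. -/
theorem whisker20 {A X1 : C} {a1 : A ⟶ X1} {a2 : X1 ⟶ A} (h : a1 ≫ a2 = 𝟙 A) (V : C) :
    V ◁ a1 ≫ V ◁ a2 = 𝟙 _ := by
  rw [← whiskerLeft_comp, h, whiskerLeft_id]

theorem whisker21 {A B X1 : C} {a1 : A ⟶ X1} {a2 : X1 ⟶ B}
    {b1 : A ⟶ B} (h : a1 ≫ a2 = b1) (V : C) :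
    V ◁ a1 ≫ V ◁ a2 = V ◁ b1 := by
  simp only [← whiskerLeft_comp, h]

theorem whisker22 {A B X1 Y1 : C} {a1 : A ⟶ X1} {a2 : X1 ⟶ B}
    {b1 : A ⟶ Y1} {b2 : Y1 ⟶ B} (h : a1 ≫ a2 = b1 ≫ b2) (V : C) :
    V ◁ a1 ≫ V ◁ a2 = V ◁ b1 ≫ V ◁ b2 := by
  simp only [← whiskerLeft_comp, h]

theorem whisker32 {A B X1 X2 Y1 : C} {a1 : A ⟶ X1} {a2 : X1 ⟶ X2} {a3 : X2 ⟶ B}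
    {b1 : A ⟶ Y1} {b2 : Y1 ⟶ B} (h : a1 ≫ a2 ≫ a3 = b1 ≫ b2) (V : C) :
    V ◁ a1 ≫ V ◁ a2 ≫ V ◁ a3 = V ◁ b1 ≫ V ◁ b2 := by
  simp only [← whiskerLeft_comp, h]

theorem whisker23 {A B X1 Y1 Y2 : C} {a1 : A ⟶ X1} {a2 : X1 ⟶ B}
    {b1 : A ⟶ Y1} {b2 : Y1 ⟶ Y2} {b3 : Y2 ⟶ B} (h : a1 ≫ a2 = b1 ≫ b2 ≫ b3) (V : C) :
    V ◁ a1 ≫ V ◁ a2 = V ◁ b1 ≫ V ◁ b2 ≫ V ◁ b3 := by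
  simp only [← whiskerLeft_comp, h]

theorem whisker33 {A B X1 X2 Y1 Y2 : C} {a1 : A ⟶ X1} {a2 : X1 ⟶ X2} {a3 : X2 ⟶ B}
    {b1 : A ⟶ Y1} {b2 : Y1 ⟶ Y2} {b3 : Y2 ⟶ B} (h : a1 ≫ a2 ≫ a3 = b1 ≫ b2 ≫ b3) (V : C) :
    V ◁ a1 ≫ V ◁ a2 ≫ V ◁ a3 = V ◁ b1 ≫ V ◁ b2 ≫ V ◁ b3 := by
  simp only [← whiskerLeft_comp, h]

theorem whisker31 {A B X1 X2 : C} {a1 : A ⟶ X1} {a2 : X1 ⟶ X2} {a3 : X2 ⟶ B}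
    {b1 : A ⟶ B} (h : a1 ≫ a2 ≫ a3 = b1) (V : C) :
    V ◁ a1 ≫ V ◁ a2 ≫ V ◁ a3 = V ◁ b1 := by
  simp only [← whiskerLeft_comp, h]

end Strings

/-! ### Moving morphisms past a strand -/

section Braided
variable {C : Type u} [Category.{v} C] [MonoidalCategory C] [BraidedCategory C]

/-- The lemmas `braidmn_left` and `braidmn_right` move a morphism with `m` input and `n` output
strands past a strand `V` on its right, respectively on its left. -/
theorem braid11_left {X W : C} (f : X ⟶ W) (V Z : C) :
    f ▷ (V ⊗ Z) ≫ op22 (β_ W V).hom Z = op22 (β_ X V).hom Z ≫ V ◁ f ▷ Z := by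
  simp only [op22]
  calc _ = (α_ _ _ _).inv ≫ (f ▷ V ≫ (β_ W V).hom) ▷ Z ≫ (α_ _ _ _).hom := by monoidal
    _ = _ := by rw [BraidedCategory.braiding_naturality_left]; monoidal

theorem braid11_right {X W : C} (f : X ⟶ W) (V Z : C) :
    V ◁ f ▷ Z ≫ op22 (β_ V W).hom Z = op22 (β_ V X).hom Z ≫ f ▷ (V ⊗ Z) := by
  simp only [op22]
  calc _ = (α_ _ _ _).inv ≫ (V ◁ f ≫ (β_ V W).hom) ▷ Z ≫ (α_ _ _ _).hom := by monoidal
    _ = _ := by rw [BraidedCategory.braiding_naturality_right]; monoidal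

theorem braid_tensor_left (X Y V Z : C) :
    (α_ X Y (V ⊗ Z)).hom ≫ X ◁ op22 (β_ Y V).hom Z ≫ op22 (β_ X V).hom (Y ⊗ Z) =
      op22 (β_ (X ⊗ Y) V).hom Z ≫ V ◁ (α_ X Y Z).hom := by
  simp only [op22, BraidedCategory.braiding_tensor_left_hom]
  monoidal

theorem braid_tensor_right (X Y V Z : C) :
    op22 (β_ V X).hom (Y ⊗ Z) ≫ X ◁ op22 (β_ V Y).hom Z ≫ (α_ X Y (V ⊗ Z)).inv =
      V ◁ (α_ X Y Z).inv ≫ op22 (β_ V (X ⊗ Y)).hom Z := by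
  simp only [op22, BraidedCategory.braiding_tensor_right_hom]
  monoidal

theorem braid_tensor_left_inv (X Y V Z : C) :
    X ◁ op22 (β_ Y V).hom Z ≫ op22 (β_ X V).hom (Y ⊗ Z) ≫ V ◁ (α_ X Y Z).inv =
      (α_ X Y (V ⊗ Z)).inv ≫ op22 (β_ (X ⊗ Y) V).hom Z := by
  simp only [op22, BraidedCategory.braiding_tensor_left_hom]
  monoidal

theorem braid_tensor_right_hom (X Y V Z : C) :
    V ◁ (α_ X Y Z).hom ≫ op22 (β_ V X).hom (Y ⊗ Z) ≫ X ◁ op22 (β_ V Y).hom Z =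
      op22 (β_ V (X ⊗ Y)).hom Z ≫ (α_ X Y (V ⊗ Z)).hom := by
  simp only [op22, BraidedCategory.braiding_tensor_right_hom]
  monoidal

theorem braid_unit_left (V Z : C) :
    op22 (β_ (𝟙_ C) V).hom Z ≫ V ◁ (λ_ Z).hom = (λ_ (V ⊗ Z)).hom := by
  simp only [op22, braiding_tensorUnit_left]
  monoidal

theorem braid_unit_right (V Z : C) :
    op22 (β_ V (𝟙_ C)).hom Z ≫ (λ_ (V ⊗ Z)).hom = V ◁ (λ_ Z).hom := by
  simp only [op22, braiding_tensorUnit_right]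
  monoidal

theorem braid21_left {X Y W : C} (f : X ⊗ Y ⟶ W) (V Z : C) :
    op21 f (V ⊗ Z) ≫ op22 (β_ W V).hom Z =
      X ◁ op22 (β_ Y V).hom Z ≫ op22 (β_ X V).hom (Y ⊗ Z) ≫ V ◁ op21 f Z := by
  simp only [op21, Category.assoc, whiskerLeft_comp, reassoc_of% (braid_tensor_left_inv X Y V Z),
    braid11_left]

theorem braid21_right {X Y W : C} (f : X ⊗ Y ⟶ W) (V Z : C) :
    V ◁ op21 f Z ≫ op22 (β_ V W).hom Z =
      op22 (β_ V X).hom (Y ⊗ Z) ≫ X ◁ op22 (β_ V Y).hom Z ≫ op21 f (V ⊗ Z) := by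
  simp only [op21, Category.assoc, whiskerLeft_comp, reassoc_of% (braid_tensor_right X Y V Z),
    braid11_right]

theorem braid12_left {X Y W : C} (f : X ⟶ Y ⊗ W) (V Z : C) :
    op12 f (V ⊗ Z) ≫ Y ◁ op22 (β_ W V).hom Z ≫ op22 (β_ Y V).hom (W ⊗ Z) =
      op22 (β_ X V).hom Z ≫ V ◁ op12 f Z := by
  simp only [op12, Category.assoc, whiskerLeft_comp, braid_tensor_left,
    reassoc_of% (braid11_left f V Z)]

theorem braid12_right {X Y W : C} (f : X ⟶ Y ⊗ W) (V Z : C) :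
    V ◁ op12 f Z ≫ op22 (β_ V Y).hom (W ⊗ Z) ≫ Y ◁ op22 (β_ V W).hom Z =
      op22 (β_ V X).hom Z ≫ op12 f (V ⊗ Z) := by
  simp only [op12, Category.assoc, whiskerLeft_comp, braid_tensor_right_hom,
    reassoc_of% (braid11_right f V Z)]

theorem braid20_left {X Y : C} (f : X ⊗ Y ⟶ 𝟙_ C) (V Z : C) :
    X ◁ op22 (β_ Y V).hom Z ≫ op22 (β_ X V).hom (Y ⊗ Z) ≫ V ◁ op20 f Z =
      op20 f (V ⊗ Z) := by
  simp only [op20, whiskerLeft_comp, reassoc_of% (braid_tensor_left_inv X Y V Z),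
    ← reassoc_of% (braid11_left f V Z), braid_unit_left]

theorem braid20_right {X Y : C} (f : X ⊗ Y ⟶ 𝟙_ C) (V Z : C) :
    op22 (β_ V X).hom (Y ⊗ Z) ≫ X ◁ op22 (β_ V Y).hom Z ≫ op20 f (V ⊗ Z) =
      V ◁ op20 f Z := by
  simp only [op20, whiskerLeft_comp, reassoc_of% (braid_tensor_right X Y V Z),
    ← reassoc_of% (braid11_right f V Z), braid_unit_right]

theorem braid01_left {X : C} (f : 𝟙_ C ⟶ X) (V Z : C) :
    op01 f (V ⊗ Z) ≫ op22 (β_ X V).hom Z = V ◁ op01 f Z := by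
  rw [op01, Category.assoc, braid11_left, ← Category.assoc, op01, whiskerLeft_comp]
  congr 1
  rw [Iso.inv_comp_eq, ← braid_unit_left, Category.assoc, ← whiskerLeft_comp, Iso.hom_inv_id,
    whiskerLeft_id, Category.comp_id]

theorem braid01_right {X : C} (f : 𝟙_ C ⟶ X) (V Z : C) :
    V ◁ op01 f Z ≫ op22 (β_ V X).hom Z = op01 f (V ⊗ Z) := by
  rw [op01, whiskerLeft_comp, Category.assoc, braid11_right, ← Category.assoc, op01]
  congr 1
  rw [← cancel_mono (λ_ (V ⊗ Z)).hom, Category.assoc, braid_unit_right, ← whiskerLeft_comp,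
    Iso.inv_hom_id, Iso.inv_hom_id, whiskerLeft_id]

theorem braid22_left {X Y P Q : C} (f : X ⊗ Y ⟶ P ⊗ Q) (V Z : C) :
    op22 f (V ⊗ Z) ≫ P ◁ op22 (β_ Q V).hom Z ≫ op22 (β_ P V).hom (Q ⊗ Z) =
      X ◁ op22 (β_ Y V).hom Z ≫ op22 (β_ X V).hom (Y ⊗ Z) ≫ V ◁ op22 f Z := by
  rw [op22, Category.assoc, Category.assoc, braid_tensor_left, reassoc_of% (braid11_left f V Z),
    ← reassoc_of% (braid_tensor_left_inv X Y V Z)]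
  simp only [op22, whiskerLeft_comp]

end Braided

/-! ### Algebras and comodules on words -/

theorem ext_whiskerRight {C : Type u} [Category.{v} C] [MonoidalCategory C] {X Y : C} {f g : X ⟶ Y}
    (h : ∀ Z : C, f ▷ Z = g ▷ Z) : f = g := by
  have := h (𝟙_ C)
  simpa using this

section
variable {C : Type u} [Category.{v} C] [MonoidalCategory C]

theorem op_mul_assoc {X : C} {m : X ⊗ X ⟶ X} (h : m ▷ X ≫ m = (α_ X X X).hom ≫ X ◁ m ≫ m) (Z : C) :
    op21 m (X ⊗ Z) ≫ op21 m Z = X ◁ op21 m Z ≫ op21 m Z := by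
  simp only [op21]
  calc _ = (α_ _ _ _).inv ≫ (α_ _ _ _).inv ≫ (m ▷ X ≫ m) ▷ Z := by monoidal
    _ = _ := by rw [h]; monoidal

theorem op_one_mul {X Y : C} {e : 𝟙_ C ⟶ Y} {m : Y ⊗ X ⟶ X} (h : e ▷ X ≫ m = (λ_ X).hom) (Z : C) :
    op01 e (X ⊗ Z) ≫ op21 m Z = 𝟙 _ := by
  simp only [op21, op01]
  calc _ = (λ_ _).inv ≫ (α_ _ _ _).inv ≫ (e ▷ X ≫ m) ▷ Z := by monoidal
    _ = _ := by rw [h]; monoidal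

theorem op_mul_one {X : C} {e : 𝟙_ C ⟶ X} {m : X ⊗ X ⟶ X} (h : X ◁ e ≫ m = (ρ_ X).hom) (Z : C) :
    X ◁ op01 e Z ≫ op21 m Z = 𝟙 _ := by
  simp only [op21, op01]
  calc _ = X ◁ (λ_ _).inv ≫ (α_ _ _ _).inv ≫ (X ◁ e ≫ m) ▷ Z := by monoidal
    _ = _ := by rw [h]; monoidal

theorem op_coact_counit {X H : C} {δ : X ⟶ X ⊗ H} {c : H ⟶ 𝟙_ C} (h : δ ≫ X ◁ c = (ρ_ X).inv)
    (Z : C) :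
    op12 δ Z ≫ X ◁ op10 c Z = 𝟙 _ := by
  simp only [op12, op10]
  calc _ = (δ ≫ X ◁ c) ▷ Z ≫ (α_ _ _ _).hom ≫ X ◁ (λ_ _).hom := by monoidal
    _ = _ := by rw [h]; monoidal

end

section Braided
variable {C : Type u} [Category.{v} C] [MonoidalCategory C] [BraidedCategory C]

/-- `δ : A ⟶ A ⊗ H` makes the algebra `(A, e, m)` a right comodule algebra over the bialgebra `H`.
In contrast to `IsComoduleAlgebra`, the algebra is unbundled, so that this applies to smash
products. -/
structure IsComodAlg (H : C) [BimonObj H] {A : C} (e : 𝟙_ C ⟶ A) (m : A ⊗ A ⟶ A)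
    (δ : A ⟶ A ⊗ H) : Prop where
  isAlgebra : IsAlgebra e m
  counit : δ ≫ A ◁ ε[H] = (ρ_ A).inv
  coassoc : δ ≫ δ ▷ H ≫ (α_ A H H).hom = δ ≫ A ◁ Δ[H]
  one : e ≫ δ = (λ_ (𝟙_ C)).inv ≫ (e ⊗ₘ η[H])
  mul : m ≫ δ = (δ ⊗ₘ δ) ≫ tensorμ A H A H ≫ (m ⊗ₘ μ[H])

/-- The action `f ⊗ a ↦ a₀⟨f, a₁⟩` of `K` on a right `H`-comodule `(A, δ)`, the strand `f` passing
`a₀` by the braiding. -/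
def coact {H K : C} (ev : K ⊗ H ⟶ 𝟙_ C) {A : C} (δ : A ⟶ A ⊗ H) : K ⊗ A ⟶ A :=
  K ◁ δ ≫ (α_ K A H).inv ≫ (β_ K A).hom ▷ H ≫ (α_ A K H).hom ≫ A ◁ ev ≫ (ρ_ A).hom

theorem op21_coact {H K : C} (ev : K ⊗ H ⟶ 𝟙_ C) {A : C} (δ : A ⟶ A ⊗ H) (Z : C) :
    op21 (coact ev δ) Z = K ◁ op12 δ Z ≫ op22 (β_ K A).hom (H ⊗ Z) ≫ A ◁ op20 ev Z := by
  simp only [op21, op12, op22, op20, coact]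
  monoidal

theorem op_coassoc {A H : C} [BimonObj H] {δ : A ⟶ A ⊗ H}
    (h : δ ≫ δ ▷ H ≫ (α_ A H H).hom = δ ≫ A ◁ Δ[H]) (Z : C) :
    op12 δ Z ≫ op12 δ (H ⊗ Z) = op12 δ Z ≫ A ◁ op12 Δ[H] Z := by
  simp only [op12]
  calc _ = (δ ≫ δ ▷ H ≫ (α_ A H H).hom) ▷ Z ≫ (α_ _ _ _).hom ≫ A ◁ (α_ _ _ _).hom := by monoidal
    _ = _ := by rw [h]; monoidal

/-! ### Module algebras from comodule algebras -/

section Pair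
variable {H K : C} [HopfObj H] [HopfObj K] {ev : K ⊗ H ⟶ 𝟙_ C}

theorem op_pair_mul (h : IsQuasiDual H K ev) (Z : C) :
    K ◁ op21 μ[H] Z ≫ op20 ev Z = op12 Δ[K] (H ⊗ (H ⊗ Z)) ≫ K ◁ op22 (β_ K H).hom (H ⊗ Z) ≫
      op20 ev (K ⊗ (H ⊗ Z)) ≫ op20 ev Z := by
  simp only [op21, op12, op22, op20]
  calc _ = K ◁ (α_ H H Z).inv ≫ (α_ _ _ _).inv ≫ (K ◁ μ[H] ≫ ev) ▷ Z ≫ (λ_ _).hom := by monoidal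
    _ = _ := by rw [h.pair_mul, pairing₂, tensorμ, MonoidalCategory.tensorHom_def]; monoidal

theorem op_mul_pair (h : IsQuasiDual H K ev) (Z : C) :
    op21 μ[K] (H ⊗ Z) ≫ op20 ev Z = K ◁ K ◁ op12 Δ[H] Z ≫ K ◁ op22 (β_ K H).hom (H ⊗ Z) ≫
      op20 ev (K ⊗ (H ⊗ Z)) ≫ op20 ev Z := by
  simp only [op21, op12, op22, op20]
  calc _ = (α_ _ _ _).inv ≫ (α_ _ _ _).inv ≫ (μ[K] ▷ H ≫ ev) ▷ Z ≫ (λ_ _).hom := by monoidal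
    _ = _ := by rw [h.mul_pair, pairing₂, tensorμ, MonoidalCategory.tensorHom_def]; monoidal

theorem op_pair_one (h : IsQuasiDual H K ev) (Z : C) :
    K ◁ op01 η[H] Z ≫ op20 ev Z = op10 ε[K] Z := by
  simp only [op01, op10, op20]
  calc _ = K ◁ (λ_ Z).inv ≫ (α_ _ _ _).inv ≫ (K ◁ η[H] ≫ ev) ▷ Z ≫ (λ_ _).hom := by monoidal
    _ = _ := by rw [h.pair_one]; monoidal

theorem op_one_pair (h : IsQuasiDual H K ev) (Z : C) :
    op01 η[K] (H ⊗ Z) ≫ op20 ev Z = op10 ε[H] Z := by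
  simp only [op01, op10, op20]
  calc _ = (λ_ _).inv ≫ (α_ _ _ _).inv ≫ (η[K] ▷ H ≫ ev) ▷ Z ≫ (λ_ _).hom := by monoidal
    _ = _ := by rw [h.one_pair]; monoidal

variable {A : C} {e : 𝟙_ C ⟶ A} {m : A ⊗ A ⟶ A} {δ : A ⟶ A ⊗ H}

theorem op_coact_mul_act (h : IsQuasiDual H K ev) (hδ : IsComodAlg H e m δ) (Z : C) :
    op21 μ[K] (A ⊗ Z) ≫ op21 (coact ev δ) Z =
      K ◁ op21 (coact ev δ) Z ≫ op21 (coact ev δ) Z := by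
  simp only [op21_coact, whiskerLeft_comp, Category.assoc]
  rw [← reassoc_of% (nat21 μ[K] (op12 δ Z)), reassoc_of% (braid21_left μ[K] A (H ⊗ Z)),
    ← whiskerLeft_comp, op_mul_pair h, reassoc_of% (whisker22 (nat12 δ (op20 ev Z)) K),
    reassoc_of% (whisker23 (braid12_right δ K (H ⊗ Z)).symm K),
    reassoc_of% (whisker22 (whisker22 (op_coassoc hδ.coassoc Z) K) K),
    reassoc_of% (nat22 (β_ K A).hom (H ◁ op20 ev Z)),
    reassoc_of% (nat22 (β_ K A).hom (op22 (β_ K H).hom (H ⊗ Z))),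
    whisker22 (nat20 ev (op20 ev Z)) A,
    reassoc_of% (whisker22 (nat22 (β_ K A).hom (op12 Δ[H] Z)) K),
    reassoc_of% (nat22 (β_ K A).hom (K ◁ op12 Δ[H] Z))]
  simp only [whiskerLeft_comp]

theorem op_comod_mul (hδ : IsComodAlg H e m δ) (Z : C) :
    op21 m Z ≫ op12 δ Z = op12 δ (A ⊗ Z) ≫ A ◁ H ◁ op12 δ Z ≫ A ◁ op22 (β_ H A).hom (H ⊗ Z) ≫
      op21 m (H ⊗ (H ⊗ Z)) ≫ A ◁ op21 μ[H] Z := by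
  simp only [op21, op12, op22]
  calc _ = (α_ _ _ _).inv ≫ (m ≫ δ) ▷ Z ≫ (α_ _ _ _).hom := by monoidal
    _ = _ := by
      rw [hδ.mul, tensorμ, MonoidalCategory.tensorHom_def, MonoidalCategory.tensorHom_def]
      monoidal

theorem op_comod_one (hδ : IsComodAlg H e m δ) (Z : C) :
    op01 e Z ≫ op12 δ Z = op01 η[H] Z ≫ op01 e (H ⊗ Z) := by
  rw [nat01]
  simp only [op01, op12]
  calc _ = (λ_ _).inv ≫ (e ≫ δ) ▷ Z ≫ (α_ _ _ _).hom := by monoidal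
    _ = _ := by rw [hδ.one, MonoidalCategory.tensorHom_def]; monoidal

theorem op_one_coact (h : IsQuasiDual H K ev) (hδ : IsComodAlg H e m δ) (Z : C) :
    op01 η[K] (A ⊗ Z) ≫ op21 (coact ev δ) Z = 𝟙 _ := by
  rw [op21_coact, ← reassoc_of% (nat01 η[K] (op12 δ Z)), reassoc_of% (braid01_left η[K] A (H ⊗ Z)),
    whisker21 (op_one_pair h Z) A, op_coact_counit hδ.counit]

theorem op_coact_one (h : IsQuasiDual H K ev) (hδ : IsComodAlg H e m δ) (Z : C) :
    K ◁ op01 e Z ≫ op21 (coact ev δ) Z = op10 ε[K] Z ≫ op01 e Z := by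
  rw [op21_coact, reassoc_of% (whisker22 (op_comod_one hδ Z) K),
    reassoc_of% (braid01_right e K (H ⊗ Z)), ← nat01, reassoc_of% (op_pair_one h Z)]

theorem op_coact_mul (h : IsQuasiDual H K ev) (hδ : IsComodAlg H e m δ) (Z : C) :
    K ◁ op21 m Z ≫ op21 (coact ev δ) Z = op12 Δ[K] (A ⊗ (A ⊗ Z)) ≫
      K ◁ op22 (β_ K A).hom (A ⊗ Z) ≫ op21 (coact ev δ) (K ⊗ (A ⊗ Z)) ≫
        A ◁ op21 (coact ev δ) Z ≫ op21 m Z := by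
  -- Both sides become words that first comultiply `K` and coact on both factors of `A`; these words
  -- differ only in the order of the braidings, which `braid22_left` (Yang-Baxter) adjusts.
  have hl : K ◁ op21 m Z ≫ op21 (coact ev δ) Z =
      op12 Δ[K] (A ⊗ (A ⊗ Z)) ≫ K ◁ K ◁ op12 δ (A ⊗ Z) ≫ K ◁ K ◁ A ◁ H ◁ op12 δ Z ≫
        K ◁ K ◁ A ◁ op22 (β_ H A).hom (H ⊗ Z) ≫ K ◁ op22 (β_ K A).hom _ ≫ op22 (β_ K A).hom _ ≫
        A ◁ K ◁ op22 (β_ K A).hom _ ≫ A ◁ op22 (β_ K A).hom _ ≫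
        A ◁ A ◁ K ◁ op22 (β_ K H).hom _ ≫ A ◁ A ◁ op20 ev _ ≫ A ◁ A ◁ op20 ev _ ≫ op21 m Z := by
    rw [op21_coact]
    have h1 := congrArg (fun t => K ◁ t) (op_comod_mul hδ Z)
    simp only [whiskerLeft_comp] at h1
    rw [reassoc_of% h1, reassoc_of% (nat22 (β_ K A).hom (op21 μ[H] Z)),
      reassoc_of% (braid21_right m K (H ⊗ (H ⊗ Z))), ← whiskerLeft_comp, op_pair_mul h,
      ← nat21]
    simp only [whiskerLeft_comp, Category.assoc]
    rw [← reassoc_of% (whisker32 (braid12_left Δ[K] A (H ⊗ (H ⊗ Z))) A),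
      ← reassoc_of% (braid12_left Δ[K] A (A ⊗ (H ⊗ (H ⊗ Z)))),
      reassoc_of% (nat12 Δ[K] (A ◁ op22 (β_ H A).hom (H ⊗ Z))),
      reassoc_of% (nat12 Δ[K] (A ◁ H ◁ op12 δ Z)),
      reassoc_of% (nat12 Δ[K] (op12 δ (A ⊗ Z)))]
  have hr : op12 Δ[K] (A ⊗ (A ⊗ Z)) ≫
      K ◁ op22 (β_ K A).hom (A ⊗ Z) ≫ op21 (coact ev δ) (K ⊗ (A ⊗ Z)) ≫
        A ◁ op21 (coact ev δ) Z ≫ op21 m Z =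
      op12 Δ[K] (A ⊗ (A ⊗ Z)) ≫ K ◁ K ◁ op12 δ (A ⊗ Z) ≫ K ◁ K ◁ A ◁ H ◁ op12 δ Z ≫
        K ◁ op22 (β_ K A).hom _ ≫ K ◁ A ◁ op22 (β_ K H).hom _ ≫ op22 (β_ K A).hom _ ≫
        A ◁ K ◁ H ◁ op22 (β_ K A).hom _ ≫ A ◁ K ◁ op22 (β_ H A).hom _ ≫
        A ◁ op22 (β_ K A).hom _ ≫ A ◁ A ◁ op20 ev _ ≫ A ◁ A ◁ op20 ev _ ≫ op21 m Z := by
    rw [op21_coact, op21_coact]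
    simp only [whiskerLeft_comp, Category.assoc]
    rw [reassoc_of% (whisker23 (braid12_right δ K (A ⊗ Z)).symm K),
      ← reassoc_of% (whisker22 (nat20 ev (K ◁ op12 δ Z)) A),
      ← reassoc_of% (nat22 (β_ K A).hom (H ◁ K ◁ op12 δ Z)),
      ← reassoc_of% (whisker22 (whisker22 (nat22 (β_ K H).hom (op12 δ Z)) A) K),
      ← reassoc_of% (whisker22 (nat22 (β_ K A).hom (H ◁ op12 δ Z)) K),
      ← reassoc_of% (whisker22 (nat20 ev (op22 (β_ K A).hom (H ⊗ Z))) A),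
      ← reassoc_of% (whisker31 (braid20_left ev A (K ⊗ (H ⊗ Z))) A)]
  rw [hl, hr,
    ← reassoc_of% (whisker22 (nat22 (β_ K A).hom (op22 (β_ K H).hom (H ⊗ Z))) A),
    reassoc_of% (whisker22 (nat22 (β_ K A).hom (op22 (β_ H A).hom (H ⊗ Z))) K),
    reassoc_of% (nat22 (β_ K A).hom (K ◁ op22 (β_ H A).hom (H ⊗ Z))),
    ← reassoc_of% (whisker33 (whisker33 (braid22_left (β_ K H).hom A (H ⊗ Z)) K) A),
    ← reassoc_of% (nat22 (β_ K A).hom (op22 (β_ K H).hom (A ⊗ (H ⊗ Z))))]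

end Pair

section ModuleAlgebra

variable {B A : C} [BimonObj B] {e : 𝟙_ C ⟶ A} {m : A ⊗ A ⟶ A} {act : B ⊗ A ⟶ A}

/-- The module algebra axioms may be checked on words. -/
theorem IsModuleAlgebra.of_op (h : IsAlgebra e m)
    (one_act : ∀ Z, op01 η[B] (A ⊗ Z) ≫ op21 act Z = 𝟙 _)
    (mul_act : ∀ Z, op21 μ[B] (A ⊗ Z) ≫ op21 act Z = B ◁ op21 act Z ≫ op21 act Z)
    (act_one : ∀ Z, B ◁ op01 e Z ≫ op21 act Z = op10 ε[B] Z ≫ op01 e Z)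
    (act_mul : ∀ Z, B ◁ op21 m Z ≫ op21 act Z = op12 Δ[B] (A ⊗ (A ⊗ Z)) ≫
      B ◁ op22 (β_ B A).hom (A ⊗ Z) ≫ op21 act (B ⊗ (A ⊗ Z)) ≫ A ◁ op21 act Z ≫ op21 m Z) :
    IsModuleAlgebra B e m act where
  isAlgebra := h
  one_act := ext_whiskerRight fun Z => by
    calc _ = (α_ _ _ _).hom ≫ (λ_ _).hom ≫ (op01 η[B] (A ⊗ Z) ≫ op21 act Z) := by
          simp only [op01, op21]; monoidal
      _ = _ := by rw [one_act]; monoidal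
  mul_act := ext_whiskerRight fun Z => by
    calc _ = (α_ _ _ _).hom ≫ (α_ _ _ _).hom ≫ (op21 μ[B] (A ⊗ Z) ≫ op21 act Z) := by
          simp only [op21]; monoidal
      _ = _ := by rw [mul_act]; simp only [op21]; monoidal
  act_one := ext_whiskerRight fun Z => by
    calc _ = (α_ _ _ _).hom ≫ B ◁ (λ_ _).hom ≫ (B ◁ op01 e Z ≫ op21 act Z) := by
          simp only [op01, op21]; monoidal
      _ = _ := by rw [act_one]; simp only [op01, op10]; monoidal
  act_mul := ext_whiskerRight fun Z => by
    calc _ = (α_ _ _ _).hom ≫ B ◁ (α_ _ _ _).hom ≫ (B ◁ op21 m Z ≫ op21 act Z) := by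
          simp only [op21]; monoidal
      _ = _ := by
        rw [act_mul, tensorμ, MonoidalCategory.tensorHom_def]
        simp only [op21, op12, op22]
        monoidal

theorem IsModuleAlgebra.op_one_act (h : IsModuleAlgebra B e m act) (Z : C) :
    op01 η[B] (A ⊗ Z) ≫ op21 act Z = 𝟙 _ := op_one_mul h.one_act Z

theorem IsModuleAlgebra.op_mul_act (h : IsModuleAlgebra B e m act) (Z : C) :
    op21 μ[B] (A ⊗ Z) ≫ op21 act Z = B ◁ op21 act Z ≫ op21 act Z := by
  simp only [op21]
  calc _ = (α_ _ _ _).inv ≫ (α_ _ _ _).inv ≫ (μ[B] ▷ A ≫ act) ▷ Z := by monoidal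
    _ = _ := by rw [h.mul_act]; monoidal

theorem IsModuleAlgebra.op_act_one (h : IsModuleAlgebra B e m act) (Z : C) :
    B ◁ op01 e Z ≫ op21 act Z = op10 ε[B] Z ≫ op01 e Z := by
  simp only [op21, op01, op10]
  calc _ = B ◁ (λ_ _).inv ≫ (α_ _ _ _).inv ≫ (B ◁ e ≫ act) ▷ Z := by monoidal
    _ = _ := by rw [h.act_one]; monoidal

theorem IsModuleAlgebra.op_act_mul (h : IsModuleAlgebra B e m act) (Z : C) :
    B ◁ op21 m Z ≫ op21 act Z = op12 Δ[B] (A ⊗ (A ⊗ Z)) ≫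
      B ◁ op22 (β_ B A).hom (A ⊗ Z) ≫ op21 act (B ⊗ (A ⊗ Z)) ≫ A ◁ op21 act Z ≫ op21 m Z := by
  simp only [op21, op12, op22]
  calc _ = B ◁ (α_ _ _ _).inv ≫ (α_ _ _ _).inv ≫ (B ◁ m ≫ act) ▷ Z := by monoidal
    _ = _ := by rw [h.act_mul, tensorμ, MonoidalCategory.tensorHom_def]; monoidal

end ModuleAlgebra

/-- A right `H`-comodule algebra is a left module algebra over a quasi-dual `K` of `H`. All three
module algebras of the duality theorem arise in this way. -/
theorem coact_isModuleAlgebra {H K : C} [HopfObj H] [HopfObj K] {ev : K ⊗ H ⟶ 𝟙_ C}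
    (h : IsQuasiDual H K ev) {A : C} {e : 𝟙_ C ⟶ A} {m : A ⊗ A ⟶ A} {δ : A ⟶ A ⊗ H}
    (hδ : IsComodAlg H e m δ) : IsModuleAlgebra K e m (coact ev δ) :=
  .of_op hδ.isAlgebra (op_one_coact h hδ) (op_coact_mul_act h hδ) (op_coact_one h hδ)
    (op_coact_mul h hδ)

end Braided

/-! ### Twisted tensor products of algebras -/

section Twisted
variable {C : Type u} [Category.{v} C] [MonoidalCategory C]

/-- `τ : B ⊗ A ⟶ A ⊗ B` is compatible with the units and products of `A` and `B` (a distributive law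
of algebras), written with words. -/
structure IsTwist {A B : C} (eA : 𝟙_ C ⟶ A) (mA : A ⊗ A ⟶ A) (eB : 𝟙_ C ⟶ B) (mB : B ⊗ B ⟶ B)
    (τ : B ⊗ A ⟶ A ⊗ B) : Prop where
  one_left : ∀ Z, op01 eB (A ⊗ Z) ≫ op22 τ Z = A ◁ op01 eB Z
  one_right : ∀ Z, B ◁ op01 eA Z ≫ op22 τ Z = op01 eA (B ⊗ Z)
  mul_left : ∀ Z, op21 mB (A ⊗ Z) ≫ op22 τ Z = B ◁ op22 τ Z ≫ op22 τ (B ⊗ Z) ≫ A ◁ op21 mB Z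
  mul_right : ∀ Z, B ◁ op21 mA Z ≫ op22 τ Z = op22 τ (A ⊗ Z) ≫ A ◁ op22 τ Z ≫ op21 mA (B ⊗ Z)

/-- The multiplication `(a ⊗ b)(a' ⊗ b') = a τ(b ⊗ a') b'` on `A ⊗ B`. -/
def twistMul {A B : C} (mA : A ⊗ A ⟶ A) (mB : B ⊗ B ⟶ B) (τ : B ⊗ A ⟶ A ⊗ B) :
    (A ⊗ B) ⊗ (A ⊗ B) ⟶ A ⊗ B :=
  (α_ A B (A ⊗ B)).hom ≫ A ◁ (α_ B A B).inv ≫ A ◁ (τ ▷ B) ≫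
    A ◁ (α_ A B B).hom ≫ (α_ A A (B ⊗ B)).inv ≫ (mA ⊗ₘ mB)

/-- `twistMul` on right-nested strands `a, b, a', b'`. -/
def opTwistMul {A B : C} (mA : A ⊗ A ⟶ A) (mB : B ⊗ B ⟶ B) (τ : B ⊗ A ⟶ A ⊗ B) (Z : C) :
    A ⊗ (B ⊗ (A ⊗ (B ⊗ Z))) ⟶ A ⊗ (B ⊗ Z) :=
  A ◁ op22 τ (B ⊗ Z) ≫ op21 mA (B ⊗ (B ⊗ Z)) ≫ A ◁ op21 mB Z

variable {A B : C} {eA : 𝟙_ C ⟶ A} {mA : A ⊗ A ⟶ A} {eB : 𝟙_ C ⟶ B} {mB : B ⊗ B ⟶ B}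
    {τ : B ⊗ A ⟶ A ⊗ B}

theorem opTwistMul_assoc (hA : IsAlgebra eA mA) (hB : IsAlgebra eB mB)
    (h : IsTwist eA mA eB mB τ) (Z : C) :
    opTwistMul mA mB τ (A ⊗ (B ⊗ Z)) ≫ opTwistMul mA mB τ Z =
      A ◁ B ◁ opTwistMul mA mB τ Z ≫ opTwistMul mA mB τ Z := by
  simp only [opTwistMul, whiskerLeft_comp, Category.assoc]
  rw [reassoc_of% (whisker23 (h.mul_left (B ⊗ Z)) A),
    ← reassoc_of% (nat21 mA (B ◁ op22 τ (B ⊗ Z))),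
    ← reassoc_of% (nat21 mA (op22 τ (B ⊗ (B ⊗ Z)))),
    reassoc_of% (nat21 mA (op21 mB (B ⊗ Z))),
    reassoc_of% (op_mul_assoc hA.mul_assoc (B ⊗ (B ⊗ (B ⊗ Z)))),
    whisker22 (op_mul_assoc hB.mul_assoc Z) A,
    reassoc_of% (whisker22 (nat22 τ (op21 mB Z)) A),
    reassoc_of% (nat21 mA (B ◁ op21 mB Z)),
    reassoc_of% (whisker23 (h.mul_right (B ⊗ (B ⊗ Z))) A),
    reassoc_of% (whisker22 (nat22 τ (op22 τ (B ⊗ Z))) A)]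

theorem opTwistMul_one_left (hA : IsAlgebra eA mA) (hB : IsAlgebra eB mB)
    (h : IsTwist eA mA eB mB τ) (Z : C) :
    op01 eB (A ⊗ (B ⊗ Z)) ≫ op01 eA (B ⊗ (A ⊗ (B ⊗ Z))) ≫ opTwistMul mA mB τ Z = 𝟙 _ := by
  rw [opTwistMul, ← reassoc_of% (nat01 eA (op22 τ (B ⊗ Z))),
    reassoc_of% (op_one_mul hA.one_mul (B ⊗ (B ⊗ Z))),
    reassoc_of% (h.one_left (B ⊗ Z)), ← whiskerLeft_comp, op_one_mul hB.one_mul, whiskerLeft_id]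

theorem opTwistMul_one_right (hA : IsAlgebra eA mA) (hB : IsAlgebra eB mB)
    (h : IsTwist eA mA eB mB τ) (Z : C) :
    A ◁ B ◁ op01 eB Z ≫ A ◁ B ◁ op01 eA (B ⊗ Z) ≫ opTwistMul mA mB τ Z = 𝟙 _ := by
  rw [opTwistMul, reassoc_of% (whisker21 (h.one_right (B ⊗ Z)) A),
    reassoc_of% (op_mul_one hA.mul_one (B ⊗ (B ⊗ Z))),
    ← whiskerLeft_comp, op_mul_one hB.mul_one, whiskerLeft_id]

theorem twistMul_whiskerRight (mA : A ⊗ A ⟶ A) (mB : B ⊗ B ⟶ B) (τ : B ⊗ A ⟶ A ⊗ B) (Z : C) :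
    twistMul mA mB τ ▷ Z = (α_ (A ⊗ B) (A ⊗ B) Z).hom ≫ (α_ A B _).hom ≫ A ◁ B ◁ (α_ A B Z).hom ≫
      opTwistMul mA mB τ Z ≫ (α_ A B Z).inv := by
  simp only [opTwistMul, twistMul, op21, op22, MonoidalCategory.tensorHom_def]
  monoidal

theorem IsTwist.isAlgebra (hA : IsAlgebra eA mA) (hB : IsAlgebra eB mB)
    (h : IsTwist eA mA eB mB τ) :
    IsAlgebra ((λ_ (𝟙_ C)).inv ≫ (eA ⊗ₘ eB)) (twistMul mA mB τ) where
  one_mul := ext_whiskerRight fun Z => by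
    rw [comp_whiskerRight, twistMul_whiskerRight]
    calc _ = 𝟙 _ ⊗≫ (op01 eB (A ⊗ (B ⊗ Z)) ≫ op01 eA (B ⊗ (A ⊗ (B ⊗ Z))) ≫ opTwistMul mA mB τ Z)
          ⊗≫ 𝟙 _ := by
          rw [reassoc_of% (nat01 eA (op01 eB (A ⊗ (B ⊗ Z))))]
          simp only [op01, MonoidalCategory.tensorHom_def]; monoidal
      _ = _ := by rw [opTwistMul_one_left hA hB h]; monoidal
  mul_one := ext_whiskerRight fun Z => by
    rw [comp_whiskerRight, twistMul_whiskerRight]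
    calc _ = 𝟙 _ ⊗≫ (A ◁ B ◁ op01 eB Z ≫ A ◁ B ◁ op01 eA (B ⊗ Z) ≫ opTwistMul mA mB τ Z)
          ⊗≫ 𝟙 _ := by
          rw [reassoc_of% (whisker22 (whisker22 (nat01 eA (op01 eB Z)) B) A)]
          simp only [op01, MonoidalCategory.tensorHom_def]; monoidal
      _ = _ := by rw [opTwistMul_one_right hA hB h]; monoidal
  mul_assoc := ext_whiskerRight fun Z => by
    simp only [comp_whiskerRight]
    calc _ = 𝟙 _ ⊗≫ (opTwistMul mA mB τ (A ⊗ (B ⊗ Z)) ≫ opTwistMul mA mB τ Z) ⊗≫ 𝟙 _ := by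
          simp only [opTwistMul, twistMul, op21, op22, MonoidalCategory.tensorHom_def]; monoidal
      _ = _ := by
          rw [opTwistMul_assoc hA hB h]
          simp only [opTwistMul, twistMul, op21, op22, MonoidalCategory.tensorHom_def]; monoidal

theorem isAlgebra_of_monObj (X : C) [MonObj X] : IsAlgebra η[X] μ[X] where
  one_mul := MonObj.one_mul X
  mul_one := MonObj.mul_one X
  mul_assoc := MonObj.mul_assoc X

end Twisted

/-! ### Smash products -/

section Smash
variable {C : Type u} [Category.{v} C] [MonoidalCategory C] [BraidedCategory C]

theorem tensor_mul_eq_twistMul {R B : Mon C} :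
    μ[(R ⊗ B).X] = twistMul μ[R.X] μ[B.X] (β_ B.X R.X).hom := by
  rw [Mon.tensorObj_mul, twistMul, tensorμ]
  simp only [Category.assoc]

section Bialgebra
variable (B : C) [BimonObj B]

theorem op_comul_assoc (Z : C) :
    op12 Δ[B] Z ≫ op12 Δ[B] (B ⊗ Z) = op12 Δ[B] Z ≫ B ◁ op12 Δ[B] Z := by
  apply op_coassoc
  simp

theorem op_counit_comul (Z : C) : op12 Δ[B] Z ≫ op10 ε[B] (B ⊗ Z) = 𝟙 _ := by
  simp only [op12, op10]
  calc _ = (Δ[B] ≫ ε[B] ▷ B) ▷ Z ≫ (λ_ _).hom ▷ Z := by monoidal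
    _ = _ := by rw [ComonObj.counit_comul]; monoidal

theorem op_mul_comul (Z : C) :
    op21 μ[B] Z ≫ op12 Δ[B] Z = op12 Δ[B] (B ⊗ Z) ≫ B ◁ B ◁ op12 Δ[B] Z ≫
      B ◁ op22 (β_ B B).hom (B ⊗ Z) ≫ op21 μ[B] (B ⊗ (B ⊗ Z)) ≫ B ◁ op21 μ[B] Z := by
  simp only [op21, op12, op22]
  calc _ = (α_ _ _ _).inv ≫ (μ[B] ≫ Δ[B]) ▷ Z ≫ (α_ _ _ _).hom := by monoidal
    _ = _ := by
      rw [BimonObj.mul_comul, tensorμ, MonoidalCategory.tensorHom_def,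
        MonoidalCategory.tensorHom_def]
      monoidal

theorem op_one_comul (Z : C) :
    op01 η[B] Z ≫ op12 Δ[B] Z = op01 η[B] Z ≫ B ◁ op01 η[B] Z := by
  simp only [op01, op12]
  calc _ = (λ_ _).inv ≫ (η[B] ≫ Δ[B]) ▷ Z ≫ (α_ _ _ _).hom := by monoidal
    _ = _ := by
      rw [BimonObj.one_comul]
      simp only [MonObj.tensorObj.one_def, MonoidalCategory.tensorHom_def]; monoidal

end Bialgebra

variable {B A : C} [BimonObj B] {e : 𝟙_ C ⟶ A} {m : A ⊗ A ⟶ A} {act : B ⊗ A ⟶ A}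

theorem op22_smashTwist (act : B ⊗ A ⟶ A) (Z : C) :
    op22 (smashTwist B act) Z = op12 Δ[B] (A ⊗ Z) ≫ B ◁ op22 (β_ B A).hom Z ≫ op21 act (B ⊗ Z) := by
  simp only [op22, op12, op21, smashTwist]
  monoidal

/-- The interchange map of the smash product is a twist: this is what the module algebra axioms
say. -/
theorem IsModuleAlgebra.isTwist (h : IsModuleAlgebra B e m act) :
    IsTwist e m η[B] μ[B] (smashTwist B act) where
  one_left Z := by
    rw [op22_smashTwist, reassoc_of% (op_one_comul B (A ⊗ Z)),
      reassoc_of% (whisker21 (braid01_left η[B] A Z) B), nat21, reassoc_of% (h.op_one_act Z)]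
  one_right Z := by
    rw [op22_smashTwist, reassoc_of% (nat12 Δ[B] (op01 e Z)),
      reassoc_of% (whisker21 (braid01_right e B Z) B), h.op_act_one,
      reassoc_of% (op_counit_comul B Z)]
  mul_left Z := by
    rw [op22_smashTwist, op22_smashTwist, reassoc_of% (op_mul_comul B (A ⊗ Z)),
      reassoc_of% (whisker23 (braid21_left μ[B] A Z) B), nat21,
      ← reassoc_of% (nat21 μ[B] (B ◁ op22 (β_ B A).hom Z)),
      ← reassoc_of% (nat21 μ[B] (op22 (β_ B A).hom (B ⊗ Z))),
      reassoc_of% (h.op_mul_act (B ⊗ (B ⊗ Z)))]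
    simp only [whiskerLeft_comp, Category.assoc]
    rw [reassoc_of% (nat12 Δ[B] (op21 act (B ⊗ Z))),
      reassoc_of% (nat12 Δ[B] (B ◁ op22 (β_ B A).hom Z)),
      reassoc_of% (nat12 Δ[B] (op12 Δ[B] (A ⊗ Z))),
      reassoc_of% (whisker23 (braid21_right act B (B ⊗ Z)) B),
      reassoc_of% (whisker22 (nat22 (β_ B B).hom (op22 (β_ B A).hom Z)) B)]
  mul_right Z := by
    rw [op22_smashTwist, op22_smashTwist, reassoc_of% (nat12 Δ[B] (op21 m Z)),
      reassoc_of% (whisker23 (braid21_right m B Z) B), h.op_act_mul]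
    simp only [whiskerLeft_comp, Category.assoc]
    rw [reassoc_of% (nat12 Δ[B] (A ◁ op22 (β_ B A).hom Z)),
      reassoc_of% (nat12 Δ[B] (op22 (β_ B A).hom (A ⊗ Z))), reassoc_of% (op_comul_assoc B),
      ← reassoc_of% (nat21 act (op12 Δ[B] (A ⊗ Z))),
      ← reassoc_of% (nat21 act (B ◁ op22 (β_ B A).hom Z)),
      ← reassoc_of% (whisker32 (braid12_left Δ[B] A (A ⊗ Z)) B),
      reassoc_of% (whisker22 (nat22 (β_ B A).hom (op22 (β_ B A).hom Z)) B)]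

theorem IsModuleAlgebra.smash_isAlgebra (h : IsModuleAlgebra B e m act) :
    IsAlgebra (smashOne B e) (smashMul B m act) :=
  h.isTwist.isAlgebra h.isAlgebra (isAlgebra_of_monObj B)

theorem op_smashTwist_comul (act : B ⊗ A ⟶ A) (Z : C) :
    op22 (smashTwist B act) Z ≫ A ◁ op12 Δ[B] Z =
      op12 Δ[B] (A ⊗ Z) ≫ B ◁ op22 (β_ B A).hom Z ≫ op22 (smashTwist B act) (B ⊗ Z) := by
  simp only [op22_smashTwist, Category.assoc]
  rw [← nat21, ← reassoc_of% (whisker32 (braid12_left Δ[B] A Z) B),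
    reassoc_of% (nat12 Δ[B] (op22 (β_ B A).hom Z)), reassoc_of% (op_comul_assoc B)]

theorem opSmashMul_comul (act : B ⊗ A ⟶ A) (m : A ⊗ A ⟶ A) (Z : C) :
    opTwistMul m μ[B] (smashTwist B act) Z ≫ A ◁ op12 Δ[B] Z =
      A ◁ op12 Δ[B] (A ⊗ (B ⊗ Z)) ≫ A ◁ B ◁ B ◁ A ◁ op12 Δ[B] Z ≫
      A ◁ B ◁ op22 (β_ B A).hom (B ⊗ (B ⊗ Z)) ≫ A ◁ B ◁ A ◁ op22 (β_ B B).hom (B ⊗ Z) ≫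
      opTwistMul m μ[B] (smashTwist B act) (B ⊗ (B ⊗ Z)) ≫ A ◁ B ◁ op21 μ[B] Z := by
  simp only [opTwistMul, Category.assoc]
  rw [← whiskerLeft_comp, op_mul_comul]
  simp only [whiskerLeft_comp]
  rw [← reassoc_of% (nat21 m (op12 Δ[B] (B ⊗ Z))), ← reassoc_of% (nat21 m (B ◁ B ◁ op12 Δ[B] Z)),
    ← reassoc_of% (nat21 m (B ◁ op22 (β_ B B).hom (B ⊗ Z))),
    reassoc_of% (whisker23 (op_smashTwist_comul act (B ⊗ Z)) A),
    ← reassoc_of% (whisker22 (nat22 (smashTwist B act) (B ◁ op12 Δ[B] Z)) A),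
    ← reassoc_of% (whisker22 (nat22 (smashTwist B act) (op22 (β_ B B).hom (B ⊗ Z))) A),
    reassoc_of% (whisker22 (whisker22 (nat22 (β_ B A).hom (op12 Δ[B] Z)) B) A)]

/-- `A # B` is a right `B`-comodule algebra under `A ⊗ Δ`. For `B = H` this makes `R # H` an
`H`-comodule algebra, whence a `K`-module algebra. -/
theorem IsModuleAlgebra.smash_isComodAlg (h : IsModuleAlgebra B e m act) :
    IsComodAlg B (smashOne B e) (smashMul B m act) (A ◁ Δ[B] ≫ (α_ A B B).inv) where
  isAlgebra := h.smash_isAlgebra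
  counit := by
    calc _ = A ◁ (Δ[B] ≫ B ◁ ε[B]) ≫ (α_ _ _ _).inv := by monoidal
      _ = _ := by rw [ComonObj.comul_counit]; monoidal
  coassoc := by
    calc _ = A ◁ (Δ[B] ≫ Δ[B] ▷ B ≫ (α_ _ _ _).hom) ≫ (α_ _ _ _).inv := by monoidal
      _ = _ := by rw [← ComonObj.comul_assoc]; monoidal
  one := by
    rw [smashOne]
    calc _ = (λ_ _).inv ≫ e ▷ _ ≫ A ◁ (η[B] ≫ Δ[B]) ≫ (α_ _ _ _).inv := by
          rw [MonoidalCategory.tensorHom_def]; monoidal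
      _ = _ := by
        rw [BimonObj.one_comul]
        simp only [MonObj.tensorObj.one_def, MonoidalCategory.tensorHom_def]; monoidal
  mul := ext_whiskerRight fun Z => by
    calc _ = 𝟙 _ ⊗≫ (opTwistMul m μ[B] (smashTwist B act) Z ≫ A ◁ op12 Δ[B] Z) ⊗≫ 𝟙 _ := by
          rw [comp_whiskerRight,
            show smashMul B m act = twistMul m μ[B] (smashTwist B act) from rfl,
            twistMul_whiskerRight]
          simp only [op12]
          monoidal
      _ = _ := by
        rw [opSmashMul_comul, show smashMul B m act = twistMul m μ[B] (smashTwist B act) from rfl,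
          MonoidalCategory.tensorHom_def, MonoidalCategory.tensorHom_def, tensorμ,
          BraidedCategory.braiding_tensor_right_hom]
        simp only [opTwistMul, twistMul, op21, op22, op12, MonoidalCategory.tensorHom_def]
        monoidal

end Smash

/-! ### The three module algebras -/

section Flip
variable {C : Type u} [Category.{v} C] [MonoidalCategory C] [BraidedCategory C]

/-- Where the braiding is symmetric, braiding twice is the identity. -/
theorem braid_cancel {X Y : C} (h : (β_ X Y).hom = (β_ Y X).inv) (Z : C) :
    op22 (β_ X Y).hom Z ≫ op22 (β_ Y X).hom Z = 𝟙 _ := by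
  simp only [op22, h]
  calc _ = (α_ _ _ _).inv ≫ ((β_ Y X).inv ≫ (β_ Y X).hom) ▷ Z ≫ (α_ _ _ _).hom := by monoidal
    _ = _ := by rw [Iso.inv_hom_id]; monoidal

/-- The pairing `H ⊗ K ⟶ I` obtained from `ev` by the braiding. -/
def flipPairing {H K : C} (ev : K ⊗ H ⟶ 𝟙_ C) : H ⊗ K ⟶ 𝟙_ C := (β_ H K).hom ≫ ev

theorem op20_flipPairing {H K : C} (ev : K ⊗ H ⟶ 𝟙_ C) (Z : C) :
    op20 (flipPairing ev) Z = op22 (β_ H K).hom Z ≫ op20 ev Z := by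
  simp only [op20, op22, flipPairing]
  monoidal

/-- The `H`-action on a right `K`-comodule is `coact` for the flipped pairing. -/
theorem coactionAct_eq {H K : C} (ev : K ⊗ H ⟶ 𝟙_ C) {R : C} (ψ : R ⟶ R ⊗ K) :
    coactionAct H K ev ψ = coact (flipPairing ev) ψ := by
  simp [coactionAct, coact, flipPairing]

/-- The `K`-action on `R ⊗ H` is `coact` for the comodule structure `R ⊗ Δ`, that of the smash
product `R # H`. -/
theorem hitRight_eq {H K : C} [HopfObj H] (ev : K ⊗ H ⟶ 𝟙_ C) (R : C) :
    hitRight H K ev R = coact ev (R ◁ Δ[H] ≫ (α_ R H H).inv) := by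
  rw [hitRight, hit, coact, BraidedCategory.braiding_tensor_right_hom]
  calc _ = 𝟙 _ ⊗≫ ((β_ K R).hom ▷ H ≫ _ ◁ Δ[H]) ⊗≫ R ◁ (β_ K H).hom ▷ H ⊗≫ R ◁ H ◁ ev ⊗≫ 𝟙 _ := by
        monoidal
    _ = _ := by rw [← whisker_exchange]; monoidal

variable {H K : C} [HopfObj H] [HopfObj K] {ev : K ⊗ H ⟶ 𝟙_ C}

theorem op_flip_pair_mul (h : IsQuasiDual H K ev) (hs : IsSymmetricOn H K) (Z : C) :
    H ◁ op21 μ[K] Z ≫ op20 (flipPairing ev) Z = op12 Δ[H] (K ⊗ (K ⊗ Z)) ≫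
      H ◁ op22 (β_ H K).hom (K ⊗ Z) ≫ op20 (flipPairing ev) (H ⊗ (K ⊗ Z)) ≫
      op20 (flipPairing ev) Z := by
  simp only [op20_flipPairing, Category.assoc]
  rw [reassoc_of% (braid21_right μ[K] H Z), op_mul_pair h,
    ← reassoc_of% (whisker32 (braid12_left Δ[H] K Z) K),
    ← reassoc_of% (braid12_left Δ[H] K (K ⊗ Z)),
    reassoc_of% (whisker20 (braid_cancel hs.left_right (H ⊗ Z)) K),
    ← reassoc_of% (nat20 ev (op22 (β_ H K).hom Z))]

theorem op_flip_mul_pair (h : IsQuasiDual H K ev) (hs : IsSymmetricOn H K) (Z : C) :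
    op21 μ[H] (K ⊗ Z) ≫ op20 (flipPairing ev) Z = H ◁ H ◁ op12 Δ[K] Z ≫
      H ◁ op22 (β_ H K).hom (K ⊗ Z) ≫ op20 (flipPairing ev) (H ⊗ (K ⊗ Z)) ≫
      op20 (flipPairing ev) Z := by
  simp only [op20_flipPairing, Category.assoc]
  rw [reassoc_of% (braid21_left μ[H] K Z), op_pair_mul h,
    ← reassoc_of% (braid12_right Δ[K] H (H ⊗ Z)),
    ← reassoc_of% (whisker32 (braid12_right Δ[K] H Z) H),
    reassoc_of% (whisker20 (braid_cancel hs.left_right (H ⊗ Z)) K),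
    ← reassoc_of% (nat20 ev (op22 (β_ H K).hom Z)),
    reassoc_of% (nat22 (β_ H K).hom (op22 (β_ H K).hom Z))]

/-- On symmetric strands quasi-duality is a symmetric relation. -/
theorem IsQuasiDual.flip (h : IsQuasiDual H K ev) (hs : IsSymmetricOn H K) :
    IsQuasiDual K H (flipPairing ev) where
  pair_mul := ext_whiskerRight fun Z => by
    calc _ = 𝟙 _ ⊗≫ (H ◁ op21 μ[K] Z ≫ op20 (flipPairing ev) Z) ⊗≫ 𝟙 _ := by
          simp only [op20, op21]; monoidal
      _ = _ := by
        rw [op_flip_pair_mul h hs, pairing₂, tensorμ, MonoidalCategory.tensorHom_def]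
        simp only [op20, op22, op12]; monoidal
  mul_pair := ext_whiskerRight fun Z => by
    calc _ = 𝟙 _ ⊗≫ (op21 μ[H] (K ⊗ Z) ≫ op20 (flipPairing ev) Z) ⊗≫ 𝟙 _ := by
          simp only [op20, op21]; monoidal
      _ = _ := by
        rw [op_flip_mul_pair h hs, pairing₂, tensorμ, MonoidalCategory.tensorHom_def]
        simp only [op20, op22, op12]; monoidal
  pair_one := by
    rw [flipPairing, BraidedCategory.braiding_naturality_right_assoc, h.one_pair,
      braiding_tensorUnit_right]
    simp
  one_pair := by
    rw [flipPairing, BraidedCategory.braiding_naturality_left_assoc, h.pair_one,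
      braiding_tensorUnit_left]
    simp
  antipode_pair := by
    rw [flipPairing, BraidedCategory.braiding_naturality_left_assoc,
      BraidedCategory.braiding_naturality_right_assoc, h.antipode_pair]

theorem comul_isComodAlg : IsComodAlg H η[H] μ[H] Δ[H] where
  isAlgebra := isAlgebra_of_monObj H
  counit := ComonObj.comul_counit H
  coassoc := by simp
  one := by rw [BimonObj.one_comul, MonObj.tensorObj.one_def]
  mul := BimonObj.mul_comul H

theorem IsComoduleAlgebra.isComodAlg {R : C} [MonObj R] {ψ : R ⟶ R ⊗ K}
    (hψ : IsComoduleAlgebra K ψ) : IsComodAlg K η[R] μ[R] ψ where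
  isAlgebra := isAlgebra_of_monObj R
  counit := hψ.counit
  coassoc := hψ.coassoc
  one := by rw [hψ.isMonHom.one_hom, MonObj.tensorObj.one_def]
  mul := by rw [hψ.isMonHom.mul_hom, MonObj.tensorObj.mul_def]

theorem hit_isModuleAlgebra (h : IsQuasiDual H K ev) :
    IsModuleAlgebra K η[H] μ[H] (hit H K ev) :=
  coact_isModuleAlgebra h comul_isComodAlg

theorem coactionAct_isModuleAlgebra (h : IsQuasiDual H K ev) (hs : IsSymmetricOn H K) {R : C}
    [MonObj R] {ψ : R ⟶ R ⊗ K} (hψ : IsComoduleAlgebra K ψ) :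
    IsModuleAlgebra H η[R] μ[R] (coactionAct H K ev ψ) := by
  rw [coactionAct_eq]
  exact coact_isModuleAlgebra (h.flip hs) hψ.isComodAlg

theorem hitRight_isModuleAlgebra (h : IsQuasiDual H K ev) (hs : IsSymmetricOn H K) {R : C}
    [MonObj R] {ψ : R ⟶ R ⊗ K} (hψ : IsComoduleAlgebra K ψ) :
    IsModuleAlgebra K (smashOne H η[R]) (smashMulRH H K ev ψ) (hitRight H K ev R) := by
  rw [hitRight_eq]
  exact coact_isModuleAlgebra h (coactionAct_isModuleAlgebra h hs hψ).smash_isComodAlg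

end Flip

/-! ### The actions of `λ` and `ρ` on `H` -/

section Pair
variable {C : Type u} [Category.{v} C] [MonoidalCategory C] [BraidedCategory C]

/-- The smash product `A # B` acts on `A` by `(x # b)·y = x (b·y)`. -/
theorem IsModuleAlgebra.op_smash_act {B A : C} [BimonObj B] {e : 𝟙_ C ⟶ A} {m : A ⊗ A ⟶ A}
    {act : B ⊗ A ⟶ A} (h : IsModuleAlgebra B e m act) (Z : C) :
    opTwistMul m μ[B] (smashTwist B act) (A ⊗ Z) ≫ A ◁ op21 act Z ≫ op21 m Z =
      A ◁ B ◁ A ◁ op21 act Z ≫ A ◁ B ◁ op21 m Z ≫ A ◁ op21 act Z ≫ op21 m Z := by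
  have h1 : B ◁ op21 m Z ≫ op21 act Z =
      op22 (smashTwist B act) (A ⊗ Z) ≫ A ◁ op21 act Z ≫ op21 m Z := by
    rw [h.op_act_mul, op22_smashTwist]
    simp only [Category.assoc]
  rw [opTwistMul]
  simp only [Category.assoc]
  rw [reassoc_of% (whisker22 (h.op_mul_act Z) A), reassoc_of% (whisker23 h1 A),
    reassoc_of% (whisker22 (nat22 (smashTwist B act) (op21 act Z)) A),
    ← op_mul_assoc h.isAlgebra.mul_assoc,
    ← reassoc_of% (nat21 m (B ◁ op21 act Z)), ← reassoc_of% (nat21 m (op21 act Z))]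

variable {H K : C} [HopfObj H] {ev : K ⊗ H ⟶ 𝟙_ C}

/-- `f ⊗ x ↦ ⟨f, x₁⟩x₂`, the action on `H` of the elements `f ⊗ 1` under `rhoAct`. -/
def rightHit (ev : K ⊗ H ⟶ 𝟙_ C) : K ⊗ H ⟶ H :=
  K ◁ Δ[H] ≫ (α_ K H H).inv ≫ ev ▷ H ≫ (λ_ H).hom

theorem op21_rightHit (ev : K ⊗ H ⟶ 𝟙_ C) (Z : C) :
    op21 (rightHit ev) Z = K ◁ op12 Δ[H] Z ≫ op20 ev (H ⊗ Z) := by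
  simp only [op21, op12, op20, rightHit]
  monoidal

theorem op21_hit (ev : K ⊗ H ⟶ 𝟙_ C) (Z : C) :
    op21 (hit H K ev) Z = K ◁ op12 Δ[H] Z ≫ op22 (β_ K H).hom (H ⊗ Z) ≫ H ◁ op20 ev Z :=
  op21_coact ev Δ[H] Z

theorem lamAct_eq (ev : K ⊗ H ⟶ 𝟙_ C) :
    lamAct H K ev = (α_ H K H).hom ≫ H ◁ hit H K ev ≫ μ[H] := by
  rw [lamAct, hit, tensorμ, tensorHom_def']
  monoidal

/-- `(h # f) ⊗ g ↦ ⟨g, h₁⟩h₂ # f`, where `g` reaches `h` by the braiding: the correction that arises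
when `κ(g)` is moved past `h # f` in `H # K`, where `κ = λ̄ ρ(id ⊗ η)`. -/
def hitPast (ev : K ⊗ H ⟶ 𝟙_ C) : (H ⊗ K) ⊗ K ⟶ H ⊗ K :=
  (α_ H K K).hom ≫ H ◁ (β_ K K).hom ≫ (α_ H K K).inv ≫ (β_ H K).hom ▷ K ≫ rightHit ev ▷ K

/-- `hitPast` on right-nested strands `h, f, g`. -/
def opHitPast (ev : K ⊗ H ⟶ 𝟙_ C) (Z : C) : H ⊗ (K ⊗ (K ⊗ Z)) ⟶ H ⊗ (K ⊗ Z) :=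
  H ◁ op22 (β_ K K).hom Z ≫ op22 (β_ H K).hom (K ⊗ Z) ≫ op21 (rightHit ev) (K ⊗ Z)

theorem op21_hitPast (ev : K ⊗ H ⟶ 𝟙_ C) (Z : C) :
    op21 (hitPast ev) Z = (α_ H K _).hom ≫ opHitPast ev Z ≫ (α_ H K Z).inv := by
  simp only [op21, op22, hitPast, opHitPast]
  monoidal

/-- `lamAct` on right-nested strands `h, f, x`. -/
def opLamAct (ev : K ⊗ H ⟶ 𝟙_ C) (Z : C) : H ⊗ (K ⊗ (H ⊗ Z)) ⟶ H ⊗ Z :=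
  H ◁ op21 (hit H K ev) Z ≫ op21 μ[H] Z

theorem op21_lamAct (ev : K ⊗ H ⟶ 𝟙_ C) (Z : C) :
    op21 (lamAct H K ev) Z = (α_ H K _).hom ≫ opLamAct ev Z := by
  simp only [op21, lamAct_eq, opLamAct]
  monoidal

theorem rhoAct_one (ev : K ⊗ H ⟶ 𝟙_ C) :
    ((ρ_ K).inv ≫ K ◁ η[H]) ▷ H ≫ rhoAct H K ev = rightHit ev := ext_whiskerRight fun Z => by
  have h1 : K ◁ op01 η[H] (H ⊗ Z) ≫ K ◁ H ◁ op12 Δ[H] Z ≫ K ◁ op22 (β_ H H).hom (H ⊗ Z) ≫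
      op20 ev (H ⊗ (H ⊗ Z)) ≫ op22 (β_ H H).hom Z ≫ op21 μ[H] Z = op21 (rightHit ev) Z := by
    rw [op21_rightHit, ← reassoc_of% (whisker22 (nat01 η[H] (op12 Δ[H] Z)) K),
      reassoc_of% (whisker21 (braid01_left η[H] H (H ⊗ Z)) K),
      reassoc_of% (nat20 ev (op01 η[H] (H ⊗ Z))), reassoc_of% (braid01_left η[H] H Z),
      op_mul_one (isAlgebra_of_monObj H).mul_one, Category.comp_id]
  calc _ = 𝟙 _ ⊗≫ (K ◁ op01 η[H] (H ⊗ Z) ≫ K ◁ H ◁ op12 Δ[H] Z ≫ K ◁ op22 (β_ H H).hom (H ⊗ Z) ≫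
      op20 ev (H ⊗ (H ⊗ Z)) ≫ op22 (β_ H H).hom Z ≫ op21 μ[H] Z) ⊗≫ 𝟙 _ := by
        rw [rhoAct, tensorμ, MonoidalCategory.tensorHom_def]
        simp only [op01, op12, op22, op20, op21]
        monoidal
    _ = _ := by rw [h1]; simp only [op21]; monoidal

/-- The actions `hit` and `rightHit` commute, by coassociativity. -/
theorem op_hit_rightHit (ev : K ⊗ H ⟶ 𝟙_ C) (Z : C) :
    K ◁ op21 (rightHit ev) Z ≫ op21 (hit H K ev) Z =
      op22 (β_ K K).hom (H ⊗ Z) ≫ K ◁ op21 (hit H K ev) Z ≫ op21 (rightHit ev) Z := by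
  simp only [op21_rightHit, op21_hit, whiskerLeft_comp, Category.assoc]
  rw [← reassoc_of% (whisker22 (nat20 ev (op12 Δ[H] Z)) K),
    ← reassoc_of% (whisker22 (whisker22 (op_comul_assoc H Z) K) K),
    reassoc_of% (whisker22 (nat12 Δ[H] (op20 ev Z)) K),
    nat20 ev (H ◁ op20 ev Z),
    reassoc_of% (whisker23 (braid12_right Δ[H] K (H ⊗ Z)).symm K),
    reassoc_of% (nat20 ev (op22 (β_ K H).hom (H ⊗ Z))),
    ← reassoc_of% (nat22 (β_ K K).hom (op12 Δ[H] Z)),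
    ← reassoc_of% (nat22 (β_ K K).hom (op12 Δ[H] (H ⊗ Z))),
    reassoc_of% (braid20_right ev K (H ⊗ (H ⊗ Z)))]

variable [HopfObj K]

theorem op_one_rightHit (h : IsQuasiDual H K ev) (Z : C) :
    op01 η[K] (H ⊗ Z) ≫ op21 (rightHit ev) Z = 𝟙 _ := by
  rw [op21_rightHit, ← reassoc_of% (nat01 η[K] (op12 Δ[H] Z)), op_one_pair h,
    op_counit_comul]

/-- Acting by `rightHit` reverses products: it is an action of the opposite algebra of `K`. -/
theorem op_mul_rightHit (h : IsQuasiDual H K ev) (hs : IsSymmetricOn H K) (Z : C) :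
    op21 μ[K] (H ⊗ Z) ≫ op21 (rightHit ev) Z =
      op22 (β_ K K).hom (H ⊗ Z) ≫ K ◁ op21 (rightHit ev) Z ≫ op21 (rightHit ev) Z := by
  simp only [op21_rightHit, whiskerLeft_comp, Category.assoc]
  rw [← reassoc_of% (nat21 μ[K] (op12 Δ[H] Z)), op_mul_pair h,
    ← reassoc_of% (nat22 (β_ K K).hom (op12 Δ[H] Z)),
    ← reassoc_of% (whisker22 (nat20 ev (op12 Δ[H] Z)) K),
    ← reassoc_of% (nat22 (β_ K K).hom (H ◁ op12 Δ[H] Z)),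
    ← reassoc_of% (whisker22 (whisker22 (op_comul_assoc H Z) K) K),
    ← reassoc_of% (braid20_right ev K (H ⊗ (H ⊗ Z))),
    reassoc_of% (braid_cancel hs.right_right)]

/-- `rightHit` acts on products of `H` through the comultiplication of `K`. -/
theorem op_rightHit_mul (h : IsQuasiDual H K ev) (hs : IsSymmetricOn H K) (Z : C) :
    K ◁ op21 μ[H] Z ≫ op21 (rightHit ev) Z =
      op12 Δ[K] (H ⊗ (H ⊗ Z)) ≫ K ◁ op22 (β_ K H).hom (H ⊗ Z) ≫
        op21 (rightHit ev) (K ⊗ (H ⊗ Z)) ≫ H ◁ op21 (rightHit ev) Z ≫ op21 μ[H] Z := by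
  simp only [op21_rightHit, whiskerLeft_comp, Category.assoc]
  have h1 := congrArg (fun t => K ◁ t) (op_mul_comul H Z)
  simp only [whiskerLeft_comp] at h1
  rw [reassoc_of% h1, nat20 ev (op21 μ[H] Z), reassoc_of% (op_pair_mul h),
    reassoc_of% (nat12 Δ[K] (H ◁ op22 (β_ H H).hom (H ⊗ Z))),
    reassoc_of% (nat12 Δ[K] (H ◁ H ◁ op12 Δ[H] Z)),
    reassoc_of% (nat12 Δ[K] (op12 Δ[H] (H ⊗ Z)))]
  rw [← reassoc_of% (nat20 ev (H ◁ K ◁ op12 Δ[H] Z)),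
    ← reassoc_of% (braid20_right ev H (H ⊗ Z)),
    ← reassoc_of% (nat20 ev (op22 (β_ H K).hom (H ⊗ (H ⊗ Z)))),
    ← reassoc_of% (nat20 ev (K ◁ op22 (β_ H H).hom (H ⊗ Z))),
    reassoc_of% (whisker23 (braid12_right Δ[H] K (H ⊗ Z)).symm K),
    ← reassoc_of% (whisker22 (whisker22 (nat22 (β_ K H).hom (op12 Δ[H] Z)) H) K),
    reassoc_of% (whisker20 (whisker20 (braid_cancel hs.right_left (H ⊗ (H ⊗ Z))) H) K),
    ← reassoc_of% (whisker22 (nat22 (β_ K H).hom (H ◁ op12 Δ[H] Z)) K),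
    ← reassoc_of% (whisker22 (nat22 (β_ K H).hom (op22 (β_ H H).hom (H ⊗ Z))) K)]

/-- `op_rightHit_mul` with the strand of `K` brought in from behind the first factor. -/
theorem op_braid_rightHit_mul (h : IsQuasiDual H K ev) (hs : IsSymmetricOn H K) (Z : C) :
    op22 (β_ H K).hom (H ⊗ Z) ≫ K ◁ op21 μ[H] Z ≫ op21 (rightHit ev) Z =
      H ◁ op12 Δ[K] (H ⊗ Z) ≫ op22 (β_ H K).hom (K ⊗ (H ⊗ Z)) ≫
        op21 (rightHit ev) (K ⊗ (H ⊗ Z)) ≫ H ◁ op21 (rightHit ev) Z ≫ op21 μ[H] Z := by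
  rw [op_rightHit_mul h hs, ← reassoc_of% (braid12_right Δ[K] H (H ⊗ Z)),
    reassoc_of% (whisker20 (braid_cancel hs.left_right (H ⊗ Z)) K)]

theorem opHitPast_lamAct (h : IsQuasiDual H K ev) (hs : IsSymmetricOn H K) (Z : C) :
    H ◁ K ◁ op12 Δ[K] (H ⊗ Z) ≫ opHitPast ev (K ⊗ (H ⊗ Z)) ≫
        H ◁ K ◁ op21 (rightHit ev) Z ≫ opLamAct ev Z =
      H ◁ op22 (β_ K K).hom (H ⊗ Z) ≫ op22 (β_ H K).hom (K ⊗ (H ⊗ Z)) ≫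
        K ◁ opLamAct ev Z ≫ op21 (rightHit ev) Z := by
  simp only [opHitPast, opLamAct, whiskerLeft_comp, Category.assoc]
  rw [← reassoc_of% (nat22 (β_ H K).hom (op21 (hit H K ev) Z)),
    op_braid_rightHit_mul h hs,
    reassoc_of% (whisker22 (nat12 Δ[K] (op21 (hit H K ev) Z)) H),
    reassoc_of% (whisker23 (braid12_right Δ[K] K (H ⊗ Z)).symm H),
    reassoc_of% (nat22 (β_ H K).hom (K ◁ op21 (hit H K ev) Z)),
    reassoc_of% (nat21 (rightHit ev) (K ◁ op21 (hit H K ev) Z)),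
    reassoc_of% (whisker23 (op_hit_rightHit ev Z) H),
    ← reassoc_of% (nat21 (rightHit ev) (op22 (β_ K K).hom (H ⊗ Z))),
    ← reassoc_of% (nat22 (β_ H K).hom (op22 (β_ K K).hom (H ⊗ Z)))]

/-- Moving a right hit out of `λ`: in terms of elements and up to braidings, `λ(q(b, g₁))(r(g₂, x))
= r(g, λ(b)(x))`, with `q` the map `hitPast` and `r` the map `rightHit`. -/
theorem op_hitPast_lamAct (h : IsQuasiDual H K ev) (hs : IsSymmetricOn H K) (Z : C) :
    (H ⊗ K) ◁ op12 Δ[K] (H ⊗ Z) ≫ op21 (hitPast ev) (K ⊗ (H ⊗ Z)) ≫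
        (H ⊗ K) ◁ op21 (rightHit ev) Z ≫ op21 (lamAct H K ev) Z =
      op22 (β_ (H ⊗ K) K).hom (H ⊗ Z) ≫ K ◁ op21 (lamAct H K ev) Z ≫ op21 (rightHit ev) Z := by
  rw [op21_hitPast, op21_lamAct]
  calc _ = (α_ H K _).hom ≫ (H ◁ K ◁ op12 Δ[K] (H ⊗ Z) ≫ opHitPast ev (K ⊗ (H ⊗ Z)) ≫
        H ◁ K ◁ op21 (rightHit ev) Z ≫ opLamAct ev Z) := by monoidal
    _ = _ := by
      rw [opHitPast_lamAct h hs, whiskerLeft_comp, Category.assoc,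
        ← reassoc_of% (braid_tensor_left H K K (H ⊗ Z))]

/-- `λ` turns products of the smash product `H # K` into compositions. -/
theorem op_smash_lamAct (h : IsQuasiDual H K ev) (Z : C) :
    op21 (smashMulHK H K ev) (H ⊗ Z) ≫ op21 (lamAct H K ev) Z =
      (H ⊗ K) ◁ op21 (lamAct H K ev) Z ≫ op21 (lamAct H K ev) Z := by
  have h1 := (hit_isModuleAlgebra h).op_smash_act Z
  rw [op21, show smashMulHK H K ev = twistMul μ[H] μ[K] (smashTwist K (hit H K ev)) from rfl,
    twistMul_whiskerRight, op21_lamAct, opLamAct]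
  calc _ = 𝟙 _ ⊗≫ (opTwistMul μ[H] μ[K] (smashTwist K (hit H K ev)) (H ⊗ Z) ≫
        H ◁ op21 (hit H K ev) Z ≫ op21 μ[H] Z) := by monoidal
    _ = _ := by rw [h1]; monoidal

theorem op_one_lamAct (h : IsQuasiDual H K ev) (Z : C) :
    op01 (smashOne K η[H]) (H ⊗ Z) ≫ op21 (lamAct H K ev) Z = 𝟙 _ := by
  rw [op21_lamAct, opLamAct]
  calc _ = op01 η[K] (H ⊗ Z) ≫ op01 η[H] (K ⊗ (H ⊗ Z)) ≫ H ◁ op21 (hit H K ev) Z ≫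
        op21 μ[H] Z := by
        rw [reassoc_of% (nat01 η[H] (op01 η[K] (H ⊗ Z)))]
        simp only [op01, smashOne, MonoidalCategory.tensorHom_def]
        monoidal
    _ = _ := by
      rw [← reassoc_of% (nat01 η[H] (op21 (hit H K ev) Z)),
        op_one_mul (isAlgebra_of_monObj H).one_mul, Category.comp_id,
        (hit_isModuleAlgebra h).op_one_act]

end Pair

/-! ### The inverse antipode -/

section Antipode

variable {C : Type u} [Category.{v} C] [MonoidalCategory C] [BraidedCategory C]

variable {K : C} [HopfObj K]

/-- On a symmetric strand the braided antimultiplicativity of `𝒮` holds with either crossing. -/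
theorem braid_mul_antipode (hs : (β_ K K).hom = (β_ K K).inv) :
    (β_ K K).hom ≫ μ[K] ≫ 𝒮[K] = (𝒮[K] ⊗ₘ 𝒮[K]) ≫ μ[K] := by
  rw [HopfObj.mul_antipode, ← BraidedCategory.braiding_naturality_assoc]
  nth_rw 1 [hs]
  rw [Iso.inv_hom_id_assoc]

/-- The inverse antipode is an antipode for the multiplication composed with the braiding. -/
theorem comul_antipode_inv (hs : (β_ K K).hom = (β_ K K).inv) [IsIso 𝒮[K]] :
    Δ[K] ≫ K ◁ inv 𝒮[K] ≫ (β_ K K).hom ≫ μ[K] = ε[K] ≫ η[K] := by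
  rw [← cancel_mono 𝒮[K]]
  simp only [Category.assoc]
  rw [braid_mul_antipode hs, HopfObj.one_antipode, tensorHom_def', Category.assoc,
    ← whiskerLeft_comp_assoc]
  simp

theorem antipode_inv_comul (hs : (β_ K K).hom = (β_ K K).inv) [IsIso 𝒮[K]] :
    Δ[K] ≫ inv 𝒮[K] ▷ K ≫ (β_ K K).hom ≫ μ[K] = ε[K] ≫ η[K] := by
  rw [← cancel_mono 𝒮[K]]
  simp only [Category.assoc]
  rw [braid_mul_antipode hs, HopfObj.one_antipode, MonoidalCategory.tensorHom_def,
    Category.assoc, ← comp_whiskerRight_assoc]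
  simp

theorem op_comul_antipode_inv (hs : (β_ K K).hom = (β_ K K).inv) [IsIso 𝒮[K]] (Z : C) :
    op12 Δ[K] Z ≫ K ◁ inv 𝒮[K] ▷ Z ≫ op22 (β_ K K).hom Z ≫ op21 μ[K] Z =
      op10 ε[K] Z ≫ op01 η[K] Z := by
  simp only [op12, op22, op21, op10, op01]
  calc _ = (Δ[K] ≫ K ◁ inv 𝒮[K] ≫ (β_ K K).hom ≫ μ[K]) ▷ Z := by monoidal
    _ = _ := by rw [comul_antipode_inv hs]; monoidal

theorem op_antipode_inv_comul (hs : (β_ K K).hom = (β_ K K).inv) [IsIso 𝒮[K]] (Z : C) :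
    op12 Δ[K] Z ≫ inv 𝒮[K] ▷ (K ⊗ Z) ≫ op22 (β_ K K).hom Z ≫ op21 μ[K] Z =
      op10 ε[K] Z ≫ op01 η[K] Z := by
  simp only [op12, op22, op21, op10, op01]
  calc _ = (Δ[K] ≫ inv 𝒮[K] ▷ K ≫ (β_ K K).hom ≫ μ[K]) ▷ Z := by monoidal
    _ = _ := by rw [antipode_inv_comul hs]; monoidal

end Antipode

/-! ### The iterated smash product as a twisted tensor product -/

section Iterated
variable {C : Type u} [Category.{v} C] [MonoidalCategory C] [BraidedCategory C]
variable {H K : C} [HopfObj H]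

/-- `(h # f) ⊗ r ↦ h₁·r ⊗ (h₂ # f)`, the interchange of `H # K` with `R` for which the twisted
tensor product of `R` and `H # K` is the iterated smash product `(R # H) # K`. -/
def iterTwist (ev : K ⊗ H ⟶ 𝟙_ C) {R : C} (ψ : R ⟶ R ⊗ K) : (H ⊗ K) ⊗ R ⟶ R ⊗ (H ⊗ K) :=
  (α_ H K R).hom ≫ H ◁ (β_ K R).hom ≫ (α_ H R K).inv ≫
    smashTwist H (coactionAct H K ev ψ) ▷ K ≫ (α_ R H K).hom

theorem op_iterTwist_eq (ev : K ⊗ H ⟶ 𝟙_ C) {R : C} (ψ : R ⟶ R ⊗ K) (Z : C) :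
    H ◁ op22 (β_ K R).hom Z ≫ op22 (smashTwist H (coactionAct H K ev ψ)) (K ⊗ Z) =
      H ◁ K ◁ op12 ψ Z ≫ H ◁ op22 (β_ K R).hom (K ⊗ Z) ≫ op22 (β_ H R).hom (K ⊗ (K ⊗ Z)) ≫
        R ◁ opHitPast ev Z := by
  rw [op22_smashTwist, coactionAct_eq, op21_coact, op20_flipPairing, opHitPast, op21_rightHit]
  simp only [whiskerLeft_comp]
  rw [reassoc_of% (whisker23 (braid12_right ψ H (K ⊗ Z)).symm H),
    ← reassoc_of% (nat12 Δ[H] (op12 ψ (K ⊗ Z))),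
    reassoc_of% (whisker23 (braid12_right ψ K Z).symm H),
    reassoc_of% (nat22 (β_ H R).hom (op22 (β_ H K).hom (K ⊗ Z))),
    reassoc_of% (braid12_left Δ[H] R (K ⊗ (K ⊗ Z))),
    reassoc_of% (nat22 (β_ H R).hom (op22 (β_ K K).hom Z)),
    reassoc_of% (whisker32 (braid12_left Δ[H] K (K ⊗ Z)) R)]

/-- The interchange `iterTwist` depends on `R` only through the coaction: it is the coaction of `R`,
followed by the braiding of `H # K` with `R` and by `hitPast`. -/
theorem op22_iterTwist (ev : K ⊗ H ⟶ 𝟙_ C) {R : C} (ψ : R ⟶ R ⊗ K) (Z : C) :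
    op22 (iterTwist ev ψ) Z =
      (H ⊗ K) ◁ op12 ψ Z ≫ op22 (β_ (H ⊗ K) R).hom (K ⊗ Z) ≫ R ◁ op21 (hitPast ev) Z := by
  rw [op21_hitPast, whiskerLeft_comp, whiskerLeft_comp,
    ← reassoc_of% (braid_tensor_left H K R (K ⊗ Z))]
  calc _ = (α_ H K _).hom ≫ (H ◁ op22 (β_ K R).hom Z ≫
        op22 (smashTwist H (coactionAct H K ev ψ)) (K ⊗ Z)) ≫ R ◁ (α_ H K Z).inv := by
        simp only [op22, iterTwist]; monoidal
    _ = _ := by rw [op_iterTwist_eq]; monoidal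

variable [HopfObj K]

theorem op_smashTwist_hitRight (ev : K ⊗ H ⟶ 𝟙_ C) (R Z : C) :
    op12 Δ[K] (R ⊗ (H ⊗ Z)) ≫ K ◁ op22 (β_ K R).hom (H ⊗ Z) ≫ K ◁ R ◁ op22 (β_ K H).hom Z ≫
        op22 (β_ K R).hom (H ⊗ (K ⊗ Z)) ≫ R ◁ op21 (hit H K ev) (K ⊗ Z) =
      op22 (β_ K R).hom (H ⊗ Z) ≫ R ◁ op22 (smashTwist K (hit H K ev)) Z := by
  rw [op22_smashTwist]
  simp only [whiskerLeft_comp]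
  rw [reassoc_of% (nat22 (β_ K R).hom (op22 (β_ K H).hom Z)),
    reassoc_of% (braid12_left Δ[K] R (H ⊗ Z))]

theorem smashTwist_hitRight (ev : K ⊗ H ⟶ 𝟙_ C) (R : C) :
    smashTwist K (hitRight H K ev R) = (α_ K R H).inv ≫ (β_ K R).hom ▷ H ≫ (α_ R K H).hom ≫
      R ◁ smashTwist K (hit H K ev) ≫ (α_ R H K).inv := ext_whiskerRight fun Z => by
  calc _ = 𝟙 _ ⊗≫ (op12 Δ[K] (R ⊗ (H ⊗ Z)) ≫ K ◁ op22 (β_ K R).hom (H ⊗ Z) ≫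
        K ◁ R ◁ op22 (β_ K H).hom Z ≫
        op22 (β_ K R).hom (H ⊗ (K ⊗ Z)) ≫ R ◁ op21 (hit H K ev) (K ⊗ Z)) ⊗≫ 𝟙 _ := by
        rw [smashTwist, hitRight, BraidedCategory.braiding_tensor_right_hom]
        simp only [op12, op22, op21]
        monoidal
    _ = _ := by
        rw [op_smashTwist_hitRight]
        simp only [op22]
        monoidal

/-- Up to reassociation `(R # H) # K` is the twisted tensor product of `R` and `H # K`. -/
theorem smashMulRHK_eq (ev : K ⊗ H ⟶ 𝟙_ C) {R : C} [MonObj R] (ψ : R ⟶ R ⊗ K) :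
    smashMulRHK H K ev ψ ≫ (α_ R H K).hom = ((α_ R H K).hom ⊗ₘ (α_ R H K).hom) ≫
      twistMul μ[R] (smashMulHK H K ev) (iterTwist ev ψ) := ext_whiskerRight fun Z => by
  have h1 : R ◁ H ◁ R ◁ op22 (smashTwist K (hit H K ev)) (K ⊗ Z) ≫
      R ◁ op22 (smashTwist H (coactionAct H K ev ψ)) (H ⊗ (K ⊗ (K ⊗ Z))) ≫
      op21 μ[R] (H ⊗ (H ⊗ (K ⊗ (K ⊗ Z)))) ≫ R ◁ op21 μ[H] (K ⊗ (K ⊗ Z)) =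
      R ◁ op22 (smashTwist H (coactionAct H K ev ψ)) (K ⊗ (H ⊗ (K ⊗ Z))) ≫
      op21 μ[R] (H ⊗ (K ⊗ (H ⊗ (K ⊗ Z)))) ≫ R ◁ H ◁ op22 (smashTwist K (hit H K ev)) (K ⊗ Z) ≫
      R ◁ op21 μ[H] (K ⊗ (K ⊗ Z)) := by
    rw [reassoc_of% (whisker22 (nat22 (smashTwist H (coactionAct H K ev ψ))
        (op22 (smashTwist K (hit H K ev)) (K ⊗ Z))) R),
      reassoc_of% (nat21 μ[R] (H ◁ op22 (smashTwist K (hit H K ev)) (K ⊗ Z)))]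
  rw [show smashMulRHK H K ev ψ = twistMul (smashMulRH H K ev ψ) μ[K]
      (smashTwist K (hitRight H K ev R)) from rfl, smashTwist_hitRight,
    show smashMulRH H K ev ψ = twistMul μ[R] μ[H] (smashTwist H (coactionAct H K ev ψ)) from rfl,
    show smashMulHK H K ev = twistMul μ[H] μ[K] (smashTwist K (hit H K ev)) from rfl]
  calc _ = 𝟙 _ ⊗≫ R ◁ H ◁ op22 (β_ K R).hom (H ⊗ (K ⊗ Z)) ≫
      (R ◁ H ◁ R ◁ op22 (smashTwist K (hit H K ev)) (K ⊗ Z) ≫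
      R ◁ op22 (smashTwist H (coactionAct H K ev ψ)) (H ⊗ (K ⊗ (K ⊗ Z))) ≫
      op21 μ[R] (H ⊗ (H ⊗ (K ⊗ (K ⊗ Z)))) ≫ R ◁ op21 μ[H] (K ⊗ (K ⊗ Z))) ≫
      R ◁ H ◁ op21 μ[K] Z ⊗≫ 𝟙 _ := by
        simp only [twistMul, op22, op21, MonoidalCategory.tensorHom_def]
        monoidal
    _ = _ := by
        rw [h1]
        simp only [twistMul, op22, op21, iterTwist, MonoidalCategory.tensorHom_def]
        monoidal

theorem twistMul_iterTwist_associator_inv (ev : K ⊗ H ⟶ 𝟙_ C) {R : C} [MonObj R]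
    (ψ : R ⟶ R ⊗ K) :
    twistMul μ[R] (smashMulHK H K ev) (iterTwist ev ψ) ≫ (α_ R H K).inv =
      ((α_ R H K).inv ⊗ₘ (α_ R H K).inv) ≫ smashMulRHK H K ev ψ := by
  rw [Iso.comp_inv_eq, Category.assoc, smashMulRHK_eq, tensorHom_comp_tensorHom_assoc,
    Iso.inv_hom_id, id_tensorHom_id, Category.id_comp]

theorem smashOne_smashOne {R : C} [MonObj R] :
    smashOne K (smashOne H η[R]) =
      ((λ_ (𝟙_ C)).inv ≫ (η[R] ⊗ₘ smashOne K η[H])) ≫ (α_ R H K).inv := by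
  simp only [smashOne, MonoidalCategory.tensorHom_def]
  monoidal

end Iterated

/-! ### Untwisting a twisted tensor product -/

/-- Conditions under which the twist `T : B ⊗ R ⟶ R ⊗ B` becomes the braiding `cBR` after a change
of coordinates. Here `B` is an algebra, `(R, ψ)` a right `K`-comodule algebra and `T` is built from
`ψ` and a map `q : B ⊗ K ⟶ B` (`twist_eq`), which is made inner by an antimultiplicative map `κ : K
⟶ B`: up to braidings `q(b, k₁) κ(k₂) = κ(k) b` (`κ_exchange`).

The maps `cXY` stand for the braidings of the ambient category. They are data here, because the
structure is used in a monoidal category in which only some morphisms are natural for the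
braiding. -/
structure InnerTwist {M : Type u} [Category.{v} M] [MonoidalCategory M] {R B K : M}
    (eR : 𝟙_ M ⟶ R) (mR : R ⊗ R ⟶ R) (eB : 𝟙_ M ⟶ B) (mB : B ⊗ B ⟶ B)
    (eK : 𝟙_ M ⟶ K) (mK : K ⊗ K ⟶ K) (eps : K ⟶ 𝟙_ M) (dK : K ⟶ K ⊗ K)
    (ψ : R ⟶ R ⊗ K) (cKR : K ⊗ R ⟶ R ⊗ K) (cBR : B ⊗ R ⟶ R ⊗ B)
    (cKK : K ⊗ K ⟶ K ⊗ K) (cBK : B ⊗ K ⟶ K ⊗ B) (q : B ⊗ K ⟶ B) (κ : K ⟶ B)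
    (T : B ⊗ R ⟶ R ⊗ B) : Prop where
  algB : IsAlgebra eB mB
  counit : ∀ Z, op12 ψ Z ≫ R ◁ op10 eps Z = 𝟙 _
  coassoc : ∀ Z, op12 ψ Z ≫ op12 ψ (K ⊗ Z) = op12 ψ Z ≫ R ◁ op12 dK Z
  coact_mul : ∀ Z, op21 mR Z ≫ op12 ψ Z = op12 ψ (R ⊗ Z) ≫ R ◁ K ◁ op12 ψ Z ≫
    R ◁ op22 cKR (K ⊗ Z) ≫ op21 mR (K ⊗ (K ⊗ Z)) ≫ R ◁ op21 mK Z
  coact_one : ∀ Z, op01 eR Z ≫ op12 ψ Z = op01 eK Z ≫ op01 eR (K ⊗ Z)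
  braid_B : ∀ Z, op22 cBR Z ≫ op12 ψ (B ⊗ Z) =
    B ◁ op12 ψ Z ≫ op22 cBR (K ⊗ Z) ≫ R ◁ op22 cBK Z
  braid_K : ∀ Z, op22 cKR Z ≫ op12 ψ (K ⊗ Z) =
    K ◁ op12 ψ Z ≫ op22 cKR (K ⊗ Z) ≫ R ◁ op22 cKK Z
  braid_mul : ∀ Z, op21 mB (R ⊗ Z) ≫ op22 cBR Z =
    B ◁ op22 cBR Z ≫ op22 cBR (B ⊗ Z) ≫ R ◁ op21 mB Z
  braid_κ : ∀ Z, κ ▷ (R ⊗ Z) ≫ op22 cBR Z = op22 cKR Z ≫ R ◁ κ ▷ Z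
  braid_symm : ∀ Z, op22 cKK Z ≫ op22 cKK Z = 𝟙 _
  κ_one : ∀ Z, op01 eK Z ≫ κ ▷ Z = op01 eB Z
  κ_mul : ∀ Z, op21 mK Z ≫ κ ▷ Z = op22 cKK Z ≫ κ ▷ (K ⊗ Z) ≫ B ◁ κ ▷ Z ≫ op21 mB Z
  κ_exchange : ∀ Z, B ◁ op12 dK Z ≫ op21 q (K ⊗ Z) ≫ B ◁ κ ▷ Z ≫ op21 mB Z =
    op22 cBK Z ≫ κ ▷ (B ⊗ Z) ≫ op21 mB Z
  twist_eq : ∀ Z, op22 T Z = B ◁ op12 ψ Z ≫ op22 cBR (K ⊗ Z) ≫ R ◁ op21 q Z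

section

variable {M : Type u} [Category.{v} M] [MonoidalCategory M]

/-- The map `r ⊗ b ↦ r₀ ⊗ κ(r₁) b`. -/
def dualityMap {R B K : M} (mB : B ⊗ B ⟶ B) (ψ : R ⟶ R ⊗ K) (κ : K ⟶ B) : R ⊗ B ⟶ R ⊗ B :=
  ψ ▷ B ≫ (α_ R K B).hom ≫ R ◁ κ ▷ B ≫ R ◁ mB

/-- `dualityMap` on right-nested strands `r, b`. -/
def opDualityMap {R B K : M} (mB : B ⊗ B ⟶ B) (ψ : R ⟶ R ⊗ K) (κ : K ⟶ B) (Z : M) :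
    R ⊗ (B ⊗ Z) ⟶ R ⊗ (B ⊗ Z) :=
  op12 ψ (B ⊗ Z) ≫ R ◁ κ ▷ (B ⊗ Z) ≫ R ◁ op21 mB Z

theorem op22_dualityMap {R B K : M} (mB : B ⊗ B ⟶ B) (ψ : R ⟶ R ⊗ K) (κ : K ⟶ B) (Z : M) :
    op22 (dualityMap mB ψ κ) Z = opDualityMap mB ψ κ Z := by
  simp only [op22, op12, op21, dualityMap, opDualityMap]
  monoidal

variable {R B K : M}
    {eR : 𝟙_ M ⟶ R} {mR : R ⊗ R ⟶ R} {eB : 𝟙_ M ⟶ B} {mB : B ⊗ B ⟶ B}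
    {eK : 𝟙_ M ⟶ K} {mK : K ⊗ K ⟶ K} {eps : K ⟶ 𝟙_ M} {dK : K ⟶ K ⊗ K}
    {ψ : R ⟶ R ⊗ K} {cKR : K ⊗ R ⟶ R ⊗ K} {cBR : B ⊗ R ⟶ R ⊗ B}
    {cKK : K ⊗ K ⟶ K ⊗ K} {cBK : B ⊗ K ⟶ K ⊗ B} {q : B ⊗ K ⟶ B} {κ : K ⟶ B}
    {T : B ⊗ R ⟶ R ⊗ B}

namespace InnerTwist

/-- Moving `b` past `r₀ ⊗ κ(r₁)` by the twist amounts to moving it past `r` by the braiding and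
multiplying by `κ(r₁)` afterwards. -/
theorem exchange (h : InnerTwist eR mR eB mB eK mK eps dK ψ cKR cBR cKK cBK q κ T) (Z : M) :
    B ◁ op12 ψ Z ≫ B ◁ R ◁ κ ▷ Z ≫ op22 T (B ⊗ Z) ≫ R ◁ op21 mB Z =
      op22 cBR Z ≫ opDualityMap mB ψ κ Z := by
  rw [opDualityMap, reassoc_of% (h.braid_B Z), h.twist_eq]
  simp only [Category.assoc]
  rw [reassoc_of% (whisker22 (nat12 ψ (κ ▷ Z)) B), reassoc_of% (whisker22 (h.coassoc Z) B),
    reassoc_of% (nat22 cBR (K ◁ κ ▷ Z)), reassoc_of% (nat22 cBR (op12 dK Z)),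
    reassoc_of% (whisker22 (nat21 q (κ ▷ Z)) R), ← whiskerLeft_comp, ← whiskerLeft_comp,
    ← whiskerLeft_comp, h.κ_exchange]
  simp only [whiskerLeft_comp]

/-- How `r ⊗ r' ↦ (r r')₀ ⊗ κ((r r')₁)` splits: the two factors `κ(r₁)` and `κ(r'₁)` appear in
reversed order, since `κ` is antimultiplicative. -/
theorem mul_coact (h : InnerTwist eR mR eB mB eK mK eps dK ψ cKR cBR cKK cBK q κ T) (Z : M) :
    op21 mR Z ≫ op12 ψ Z ≫ R ◁ κ ▷ Z = op12 ψ (R ⊗ Z) ≫ R ◁ κ ▷ (R ⊗ Z) ≫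
      R ◁ op22 cBR Z ≫ R ◁ opDualityMap mB ψ κ Z ≫ op21 mR (B ⊗ Z) := by
  have hκ := congrArg (fun t => R ◁ t) (h.κ_mul Z)
  simp only [whiskerLeft_comp] at hκ
  rw [reassoc_of% (h.coact_mul Z), hκ, opDualityMap]
  simp only [whiskerLeft_comp, Category.assoc]
  rw [← reassoc_of% (nat21 mR (op22 cKK Z)), ← reassoc_of% (nat21 mR (κ ▷ (K ⊗ Z))),
    ← reassoc_of% (nat21 mR (B ◁ κ ▷ Z)), ← nat21 mR (op21 mB Z),
    reassoc_of% (whisker22 (h.braid_κ Z) R), reassoc_of% (whisker22 (nat12 ψ (κ ▷ Z)) R),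
    reassoc_of% (whisker23 (h.braid_K Z) R),
    reassoc_of% (whisker22 (whisker22 (nat11 κ (κ ▷ Z)) R) R)]

/-- Both sides reduce to one word: `κ` of the product is split by `mul_coact`, and the twist on the
other side is removed by `exchange`. -/
theorem op_map_mul (h : InnerTwist eR mR eB mB eK mK eps dK ψ cKR cBR cKK cBK q κ T) (Z : M) :
    opTwistMul mR mB cBR Z ≫ opDualityMap mB ψ κ Z =
      opDualityMap mB ψ κ (R ⊗ (B ⊗ Z)) ≫ R ◁ B ◁ opDualityMap mB ψ κ Z ≫
        opTwistMul mR mB T Z := by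
  have assoc := fun W => op_mul_assoc h.algB.mul_assoc W
  have hl : opTwistMul mR mB cBR Z ≫ opDualityMap mB ψ κ Z =
      op12 ψ (B ⊗ (R ⊗ (B ⊗ Z))) ≫ R ◁ κ ▷ (B ⊗ (R ⊗ (B ⊗ Z))) ≫
      R ◁ B ◁ op22 cBR (B ⊗ Z) ≫ R ◁ op22 cBR (B ⊗ (B ⊗ Z)) ≫
      R ◁ op12 ψ (B ⊗ (B ⊗ (B ⊗ Z))) ≫ R ◁ R ◁ κ ▷ (B ⊗ (B ⊗ (B ⊗ Z))) ≫
      R ◁ R ◁ op21 mB (B ⊗ (B ⊗ Z)) ≫ R ◁ R ◁ op21 mB (B ⊗ Z) ≫ op21 mR (B ⊗ (B ⊗ Z)) ≫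
      R ◁ op21 mB Z := by
    rw [opTwistMul]
    nth_rw 1 [opDualityMap]
    simp only [Category.assoc]
    rw [reassoc_of% (nat12 ψ (op21 mB Z)), reassoc_of% (whisker22 (nat11 κ (op21 mB Z)) R),
      reassoc_of% (h.mul_coact (B ⊗ (B ⊗ Z))), ← whisker22 (assoc Z) R,
      ← reassoc_of% (nat21 mR (op21 mB (B ⊗ Z))),
      reassoc_of% (nat12 ψ (op22 cBR (B ⊗ Z))),
      reassoc_of% (whisker22 (nat11 κ (op22 cBR (B ⊗ Z))) R), opDualityMap]
    simp only [whiskerLeft_comp, Category.assoc]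
  have hr : opDualityMap mB ψ κ (R ⊗ (B ⊗ Z)) ≫ R ◁ B ◁ opDualityMap mB ψ κ Z ≫
        opTwistMul mR mB T Z =
      opDualityMap mB ψ κ (R ⊗ (B ⊗ Z)) ≫ R ◁ op22 cBR (B ⊗ Z) ≫
        R ◁ opDualityMap mB ψ κ (B ⊗ Z) ≫ op21 mR (B ⊗ (B ⊗ Z)) ≫ R ◁ op21 mB Z := by
    have hE := congrArg (fun t => R ◁ t) (h.exchange (B ⊗ Z))
    simp only [whiskerLeft_comp] at hE
    rw [← reassoc_of% hE, opTwistMul]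
    congr 1
    rw [opDualityMap]
    simp only [whiskerLeft_comp, Category.assoc]
    rw [reassoc_of% (whisker22 (nat22 T (op21 mB Z)) R), reassoc_of% (nat21 mR (B ◁ op21 mB Z)),
      ← whisker22 (assoc Z) R, ← reassoc_of% (nat21 mR (op21 mB (B ⊗ Z)))]
  rw [hl, hr, opDualityMap, opDualityMap]
  simp only [whiskerLeft_comp, Category.assoc]
  rw [reassoc_of% (whisker23 (h.braid_mul (B ⊗ Z)) R),
    reassoc_of% (whisker22 (nat12 ψ (op21 mB (B ⊗ Z))) R),
    reassoc_of% (whisker22 (whisker22 (nat11 κ (op21 mB (B ⊗ Z))) R) R),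
    reassoc_of% (whisker22 (whisker22 (assoc (B ⊗ Z)) R) R)]

theorem op_map_one (h : InnerTwist eR mR eB mB eK mK eps dK ψ cKR cBR cKK cBK q κ T) (Z : M) :
    op01 eB Z ≫ op01 eR (B ⊗ Z) ≫ opDualityMap mB ψ κ Z = op01 eB Z ≫ op01 eR (B ⊗ Z) := by
  rw [opDualityMap, reassoc_of% (h.coact_one (B ⊗ Z)), ← reassoc_of% (nat01 eR (κ ▷ (B ⊗ Z))),
    reassoc_of% (h.κ_one (B ⊗ Z)), ← nat01 eR (op21 mB Z),
    reassoc_of% (op_one_mul h.algB.one_mul Z)]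

/-- Duality maps compose by convolution: if the convolution of `b` and `a` is trivial, then so is
the composite of their duality maps. -/
theorem op_map_comp (h : InnerTwist eR mR eB mB eK mK eps dK ψ cKR cBR cKK cBK q κ T)
    {a b : K ⟶ B}
    (hab : ∀ Z, op12 dK Z ≫ b ▷ (K ⊗ Z) ≫ B ◁ a ▷ Z ≫ op21 mB Z = op10 eps Z ≫ op01 eB Z)
    (Z : M) : opDualityMap mB ψ a Z ≫ opDualityMap mB ψ b Z = 𝟙 _ := by
  have hab' := congrArg (fun t => R ◁ t) (hab (B ⊗ Z))
  simp only [whiskerLeft_comp] at hab'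
  simp only [opDualityMap, Category.assoc]
  rw [reassoc_of% (nat12 ψ (op21 mB Z)), reassoc_of% (nat12 ψ (a ▷ (B ⊗ Z))),
    reassoc_of% (h.coassoc (B ⊗ Z)), reassoc_of% (whisker22 (nat11 b (op21 mB Z)) R),
    ← whisker22 (op_mul_assoc h.algB.mul_assoc Z) R,
    reassoc_of% (whisker22 (nat11 b (a ▷ (B ⊗ Z))) R), reassoc_of% hab',
    whisker20 (op_one_mul h.algB.one_mul Z) R, Category.comp_id, h.counit]

theorem op_κ_comp (h : InnerTwist eR mR eB mB eK mK eps dK ψ cKR cBR cKK cBK q κ T) (Z : M) :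
    κ ▷ (K ⊗ Z) ≫ B ◁ κ ▷ Z ≫ op21 mB Z = op22 cKK Z ≫ op21 mK Z ≫ κ ▷ Z := by
  rw [h.κ_mul, reassoc_of% (h.braid_symm Z)]

/-- If `s` is an inverse of the identity for the convolution twisted by `cKK`, as is an inverse
antipode, then the duality map of `s ≫ κ` inverts that of `κ`. -/
theorem op_map_inv (h : InnerTwist eR mR eB mB eK mK eps dK ψ cKR cBR cKK cBK q κ T) {s : K ⟶ K}
    (hs : ∀ Z, op12 dK Z ≫ s ▷ (K ⊗ Z) ≫ op22 cKK Z ≫ op21 mK Z = op10 eps Z ≫ op01 eK Z)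
    (Z : M) : opDualityMap mB ψ κ Z ≫ opDualityMap mB ψ (s ≫ κ) Z = 𝟙 _ :=
  h.op_map_comp (fun Z => by
    rw [comp_whiskerRight, Category.assoc, h.op_κ_comp, reassoc_of% (hs Z), h.κ_one]) Z

theorem op_inv_map (h : InnerTwist eR mR eB mB eK mK eps dK ψ cKR cBR cKK cBK q κ T) {s : K ⟶ K}
    (hs : ∀ Z, op12 dK Z ≫ K ◁ s ▷ Z ≫ op22 cKK Z ≫ op21 mK Z = op10 eps Z ≫ op01 eK Z)
    (Z : M) : opDualityMap mB ψ (s ≫ κ) Z ≫ opDualityMap mB ψ κ Z = 𝟙 _ :=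
  h.op_map_comp (fun Z => by
    rw [comp_whiskerRight, whiskerLeft_comp, Category.assoc, ← reassoc_of% (nat11 κ (s ▷ Z)),
      h.op_κ_comp, reassoc_of% (hs Z), h.κ_one]) Z

/-- `dualityMap` is multiplicative from the braided tensor product algebra `R ⊗ B` to the one
twisted by `T`. -/
theorem map_mul (h : InnerTwist eR mR eB mB eK mK eps dK ψ cKR cBR cKK cBK q κ T) :
    twistMul mR mB cBR ≫ dualityMap mB ψ κ =
      (dualityMap mB ψ κ ⊗ₘ dualityMap mB ψ κ) ≫ twistMul mR mB T :=
  ext_whiskerRight fun Z => by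
    calc _ = 𝟙 _ ⊗≫ (opTwistMul mR mB cBR Z ≫ opDualityMap mB ψ κ Z) ⊗≫ 𝟙 _ := by
          rw [comp_whiskerRight, twistMul_whiskerRight, ← op22_dualityMap]
          simp only [op22]
          monoidal
      _ = _ := by
          rw [h.op_map_mul, comp_whiskerRight, twistMul_whiskerRight, ← op22_dualityMap,
            ← op22_dualityMap, MonoidalCategory.tensorHom_def]
          simp only [op22]
          monoidal

theorem map_one (h : InnerTwist eR mR eB mB eK mK eps dK ψ cKR cBR cKK cBK q κ T) :
    ((λ_ (𝟙_ M)).inv ≫ (eR ⊗ₘ eB)) ≫ dualityMap mB ψ κ = (λ_ (𝟙_ M)).inv ≫ (eR ⊗ₘ eB) :=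
  ext_whiskerRight fun Z => by
    calc _ = 𝟙 _ ⊗≫ (op01 eB Z ≫ op01 eR (B ⊗ Z) ≫ opDualityMap mB ψ κ Z) ⊗≫ 𝟙 _ := by
          rw [reassoc_of% (nat01 eR (op01 eB Z)), ← op22_dualityMap,
            MonoidalCategory.tensorHom_def]
          simp only [op22, op01]
          monoidal
      _ = _ := by
          rw [h.op_map_one, nat01 eR (op01 eB Z), MonoidalCategory.tensorHom_def]
          simp only [op01]
          monoidal

theorem dualityMap_comp_eq_id {a b : K ⟶ B}
    (h : ∀ Z, opDualityMap mB ψ a Z ≫ opDualityMap mB ψ b Z = 𝟙 (R ⊗ (B ⊗ Z))) :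
    dualityMap mB ψ a ≫ dualityMap mB ψ b = 𝟙 (R ⊗ B) :=
  ext_whiskerRight fun Z => by
    calc _ = 𝟙 _ ⊗≫ (opDualityMap mB ψ a Z ≫ opDualityMap mB ψ b Z) ⊗≫ 𝟙 _ := by
          rw [← op22_dualityMap, ← op22_dualityMap]
          simp only [op22]
          monoidal
      _ = _ := by rw [h]; monoidal

end InnerTwist
end

/-! ### Lifting identities along a faithful action -/

section Faithful

variable {M : Type u} [Category.{v} M] [MonoidalCategory M] {H B K : M} {lam : B ⊗ H ⟶ H}
  {r : K ⊗ H ⟶ H} {κ : K ⟶ B} {eB : 𝟙_ M ⟶ B} {mB : B ⊗ B ⟶ B}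

theorem op_factor (hκ : κ ▷ H ≫ lam = r) (Z : M) :
    κ ▷ (H ⊗ Z) ≫ op21 lam Z = op21 r Z := by
  subst hκ
  simp only [op21]
  monoidal

theorem eq_of_op01 (hf : ∀ {U : M} (a b : U ⟶ B), a ▷ H ≫ lam = b ▷ H ≫ lam → a = b)
    {a b : 𝟙_ M ⟶ B}
    (h : ∀ Z, op01 a (H ⊗ Z) ≫ op21 lam Z = op01 b (H ⊗ Z) ≫ op21 lam Z) : a = b :=
  hf a b <| ext_whiskerRight fun Z => by
    have hw (c : 𝟙_ M ⟶ B) :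
        (c ▷ H ≫ lam) ▷ Z = 𝟙 _ ⊗≫ (op01 c (H ⊗ Z) ≫ op21 lam Z) ⊗≫ 𝟙 _ := by
      simp only [op01, op21]
      monoidal
    rw [hw, hw, h]

theorem eq_of_op21 (hf : ∀ {U : M} (a b : U ⟶ B), a ▷ H ≫ lam = b ▷ H ≫ lam → a = b)
    {X Y : M} {a b : X ⊗ Y ⟶ B}
    (h : ∀ Z, op21 a (H ⊗ Z) ≫ op21 lam Z = op21 b (H ⊗ Z) ≫ op21 lam Z) : a = b :=
  hf a b <| ext_whiskerRight fun Z => by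
    have hw (c : X ⊗ Y ⟶ B) :
        (c ▷ H ≫ lam) ▷ Z = 𝟙 _ ⊗≫ (op21 c (H ⊗ Z) ≫ op21 lam Z) ⊗≫ 𝟙 _ := by
      simp only [op21]
      monoidal
    rw [hw, hw, h]

theorem op_factor_one (hf : ∀ {U : M} (a b : U ⟶ B), a ▷ H ≫ lam = b ▷ H ≫ lam → a = b)
    (hκ : κ ▷ H ≫ lam = r) {eK : 𝟙_ M ⟶ K} (hr : ∀ Z, op01 eK (H ⊗ Z) ≫ op21 r Z = 𝟙 _)
    (hl : ∀ Z, op01 eB (H ⊗ Z) ≫ op21 lam Z = 𝟙 _) (Z : M) :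
    op01 eK Z ≫ κ ▷ Z = op01 eB Z := by
  have hw (W : M) : op01 (eK ≫ κ) W = op01 eK W ≫ κ ▷ W := by simp only [op01]; monoidal
  have h : eK ≫ κ = eB := eq_of_op01 hf fun W => by
    rw [hw, Category.assoc, op_factor hκ, hr, hl]
  rw [← hw, h]

/-- If `κ` becomes the action `r` under the faithful action `lam`, then `κ` is antimultiplicative
because `r` is. -/
theorem op_factor_mul (hf : ∀ {U : M} (a b : U ⟶ B), a ▷ H ≫ lam = b ▷ H ≫ lam → a = b)
    (hκ : κ ▷ H ≫ lam = r) {mK : K ⊗ K ⟶ K} {cKK : K ⊗ K ⟶ K ⊗ K}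
    (hr : ∀ Z, op21 mK (H ⊗ Z) ≫ op21 r Z = op22 cKK (H ⊗ Z) ≫ K ◁ op21 r Z ≫ op21 r Z)
    (hl : ∀ Z, op21 mB (H ⊗ Z) ≫ op21 lam Z = B ◁ op21 lam Z ≫ op21 lam Z) (Z : M) :
    op21 mK Z ≫ κ ▷ Z = op22 cKK Z ≫ κ ▷ (K ⊗ Z) ≫ B ◁ κ ▷ Z ≫ op21 mB Z := by
  have hw (W : M) : op21 (mK ≫ κ) W = op21 mK W ≫ κ ▷ W := by simp only [op21]; monoidal
  have hw' (W : M) : op21 (cKK ≫ κ ▷ K ≫ B ◁ κ ≫ mB) W =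
      op22 cKK W ≫ κ ▷ (K ⊗ W) ≫ B ◁ κ ▷ W ≫ op21 mB W := by
    simp only [op21, op22]; monoidal
  have h : mK ≫ κ = cKK ≫ κ ▷ K ≫ B ◁ κ ≫ mB := eq_of_op21 hf fun W => by
    rw [hw, hw', Category.assoc, op_factor hκ, hr]
    simp only [Category.assoc]
    rw [hl, reassoc_of% (whisker21 (op_factor hκ W) B), ← reassoc_of% (nat11 κ (op21 r W)),
      op_factor hκ]
  rw [← hw, h, hw']

/-- The exchange rule for `κ` follows from one for the actions `r` and `lam`. -/
theorem op_factor_exchange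
    (hf : ∀ {U : M} (a b : U ⟶ B), a ▷ H ≫ lam = b ▷ H ≫ lam → a = b)
    (hκ : κ ▷ H ≫ lam = r) {dK : K ⟶ K ⊗ K} {cBK : B ⊗ K ⟶ K ⊗ B} {q : B ⊗ K ⟶ B}
    (hr : ∀ Z, B ◁ op12 dK (H ⊗ Z) ≫ op21 q (K ⊗ (H ⊗ Z)) ≫ B ◁ op21 r Z ≫ op21 lam Z =
      op22 cBK (H ⊗ Z) ≫ K ◁ op21 lam Z ≫ op21 r Z)
    (hl : ∀ Z, op21 mB (H ⊗ Z) ≫ op21 lam Z = B ◁ op21 lam Z ≫ op21 lam Z) (Z : M) :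
    B ◁ op12 dK Z ≫ op21 q (K ⊗ Z) ≫ B ◁ κ ▷ Z ≫ op21 mB Z =
      op22 cBK Z ≫ κ ▷ (B ⊗ Z) ≫ op21 mB Z := by
  have hw (W : M) : op21 (B ◁ dK ≫ (α_ B K K).inv ≫ q ▷ K ≫ B ◁ κ ≫ mB) W =
      B ◁ op12 dK W ≫ op21 q (K ⊗ W) ≫ B ◁ κ ▷ W ≫ op21 mB W := by
    simp only [op21, op12]; monoidal
  have hw' (W : M) : op21 (cBK ≫ κ ▷ B ≫ mB) W = op22 cBK W ≫ κ ▷ (B ⊗ W) ≫ op21 mB W := by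
    simp only [op21, op22]; monoidal
  have h : B ◁ dK ≫ (α_ B K K).inv ≫ q ▷ K ≫ B ◁ κ ≫ mB = cBK ≫ κ ▷ B ≫ mB :=
    eq_of_op21 hf fun W => by
      rw [hw, hw']
      simp only [Category.assoc]
      rw [hl, reassoc_of% (whisker21 (op_factor hκ W) B), hr, ← reassoc_of% (nat11 κ (op21 lam W)),
        op_factor hκ]
  rw [← hw, h, hw']

theorem op_whisker_braid {R : M} {cBR : B ⊗ R ⟶ R ⊗ B} {cKR : K ⊗ R ⟶ R ⊗ K}
    (h : κ ▷ R ≫ cBR = cKR ≫ R ◁ κ) (Z : M) :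
    κ ▷ (R ⊗ Z) ≫ op22 cBR Z = op22 cKR Z ≫ R ◁ κ ▷ Z := by
  simp only [op22]
  calc _ = (α_ K R Z).inv ≫ (κ ▷ R ≫ cBR) ▷ Z ≫ (α_ R B Z).hom := by monoidal
    _ = _ := by rw [h]; monoidal

end Faithful

/-! ### The full image of a monoidal functor -/

section FullImage

variable {C : Type u} [Category.{v} C] [MonoidalCategory C]
  {D : Type u'} [Category.{v'} D] [MonoidalCategory D] (F : C ⥤ D)

/-- The category with the objects of `C` and the morphisms `F.obj X ⟶ F.obj Y` of `D`. For a
monoidal functor `F` it carries the tensor product of `C` on objects, so that words in `C` go over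
into words without the structure isomorphisms of `F`. -/
abbrev FullImage : Type u := InducedCategory D F.obj

variable {F} in
/-- The object of `C` underlying an object of the full image. -/
def FullImage.toC (X : FullImage F) : C := X

variable [F.Monoidal]

/-- Morphisms are tensored in `D`, and conjugated by the structure isomorphisms of `F`. -/
instance fullImageStruct : MonoidalCategoryStruct (FullImage F) where
  tensorObj X Y := (X.toC ⊗ Y.toC : C)
  whiskerLeft X Y Z f := InducedCategory.homMk
    (Functor.OplaxMonoidal.δ F X.toC Y.toC ≫ F.obj X.toC ◁ f.hom ≫
      Functor.LaxMonoidal.μ F X.toC Z.toC)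
  whiskerRight {X Y} f Z := InducedCategory.homMk
    (Functor.OplaxMonoidal.δ F X.toC Z.toC ≫ f.hom ▷ F.obj Z.toC ≫
      Functor.LaxMonoidal.μ F Y.toC Z.toC)
  tensorHom {X Y V W} f g := InducedCategory.homMk
    (Functor.OplaxMonoidal.δ F X.toC V.toC ≫ (f.hom ⊗ₘ g.hom) ≫
      Functor.LaxMonoidal.μ F Y.toC W.toC)
  tensorUnit := (𝟙_ C : C)
  associator X Y Z := InducedCategory.isoMk (F.mapIso (α_ X.toC Y.toC Z.toC))
  leftUnitor X := InducedCategory.isoMk (F.mapIso (λ_ X.toC))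
  rightUnitor X := InducedCategory.isoMk (F.mapIso (ρ_ X.toC))

instance fullImageMonoidal : MonoidalCategory (FullImage F) :=
  Monoidal.induced (inducedFunctor F.obj)
    { μIso := fun X Y => Functor.Monoidal.μIso F X.toC Y.toC
      εIso := Functor.Monoidal.εIso F
      whiskerLeft_eq := fun _ _ _ _ => rfl
      whiskerRight_eq := fun _ _ => rfl
      tensorHom_eq := fun _ _ => rfl
      associator_eq := fun X Y Z => by
        refine (Functor.Monoidal.map_associator F X.toC Y.toC Z.toC).trans ?_
        rw [← id_tensorHom, ← tensorHom_id]
        exact (Category.assoc _ _ _).symm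
      leftUnitor_eq := fun X => by
        refine (Functor.Monoidal.map_leftUnitor F X.toC).trans ?_
        rw [← tensorHom_id]
        exact (Category.assoc _ _ _).symm
      rightUnitor_eq := fun X => by
        refine (Functor.Monoidal.map_rightUnitor F X.toC).trans ?_
        rw [← id_tensorHom]
        exact (Category.assoc _ _ _).symm }

/-- `F`, as a functor to its full image. It preserves tensor products, units and the structure
isomorphisms definitionally. -/
def toFullImage : C ⥤ FullImage F where
  obj X := X
  map f := InducedCategory.homMk (F.map f)
  map_id _ := InducedCategory.hom_ext (F.map_id _)
  map_comp _ _ := InducedCategory.hom_ext (F.map_comp _ _)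

local notation "J" => toFullImage F

theorem toFullImage_whiskerLeft (X : C) {Y Z : C} (f : Y ⟶ Z) :
    (J).map (X ◁ f) = (J).obj X ◁ (J).map f :=
  InducedCategory.hom_ext (Functor.Monoidal.map_whiskerLeft F X f)

theorem toFullImage_whiskerRight {Y Z : C} (f : Y ⟶ Z) (X : C) :
    (J).map (f ▷ X) = (J).map f ▷ (J).obj X :=
  InducedCategory.hom_ext (Functor.Monoidal.map_whiskerRight F f X)

theorem toFullImage_tensorHom {X Y Z W : C} (f : X ⟶ Y) (g : Z ⟶ W) :
    (J).map (f ⊗ₘ g) = ((J).map f ⊗ₘ (J).map g) :=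
  InducedCategory.hom_ext (Functor.Monoidal.map_tensor F f g)

theorem toFullImage_op21 {X Y W : C} (f : X ⊗ Y ⟶ W) (Z : C) :
    (J).map (op21 f Z) = op21 (X := (J).obj X) (Y := (J).obj Y) ((J).map f) ((J).obj Z) := by
  simp only [op21, Functor.map_comp, toFullImage_whiskerRight]
  rfl

theorem toFullImage_op22 {X Y V W : C} (f : X ⊗ Y ⟶ V ⊗ W) (Z : C) :
    (J).map (op22 f Z) = op22 (X := (J).obj X) (Y := (J).obj Y) (V := (J).obj V)
      (W := (J).obj W) ((J).map f) ((J).obj Z) := by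
  simp only [op22, Functor.map_comp, toFullImage_whiskerRight]
  rfl

theorem toFullImage_op12 {X Y W : C} (f : X ⟶ Y ⊗ W) (Z : C) :
    (J).map (op12 f Z) = op12 (Y := (J).obj Y) (W := (J).obj W) ((J).map f) ((J).obj Z) := by
  simp only [op12, Functor.map_comp, toFullImage_whiskerRight]
  rfl

theorem toFullImage_op10 {X : C} (f : X ⟶ 𝟙_ C) (Z : C) :
    (J).map (op10 f Z) = op10 (X := (J).obj X) ((J).map f) ((J).obj Z) := by
  simp only [op10, Functor.map_comp, toFullImage_whiskerRight]
  rfl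

theorem toFullImage_op01 {X : C} (f : 𝟙_ C ⟶ X) (Z : C) :
    (J).map (op01 f Z) = op01 (X := (J).obj X) ((J).map f) ((J).obj Z) := by
  simp only [op01, Functor.map_comp, toFullImage_whiskerRight]
  rfl

theorem toFullImage_twistMul {A B : C} (mA : A ⊗ A ⟶ A) (mB : B ⊗ B ⟶ B)
    (τ : B ⊗ A ⟶ A ⊗ B) :
    (J).map (twistMul mA mB τ) = twistMul (A := (J).obj A) (B := (J).obj B) ((J).map mA)
      ((J).map mB) ((J).map τ) := by
  simp only [twistMul, Functor.map_comp, toFullImage_whiskerLeft, toFullImage_whiskerRight,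
    toFullImage_tensorHom]
  rfl

theorem toFullImage_dualityMap {R B K : C} (mB : B ⊗ B ⟶ B) (ψ : R ⟶ R ⊗ K) (κ : K ⟶ B) :
    (J).map (dualityMap mB ψ κ) = dualityMap (R := (J).obj R) (B := (J).obj B) (K := (J).obj K)
      ((J).map mB) ((J).map ψ) ((J).map κ) := by
  simp only [dualityMap, Functor.map_comp, toFullImage_whiskerLeft, toFullImage_whiskerRight]
  rfl

theorem IsAlgebra.toFullImage {X : C} {e : 𝟙_ C ⟶ X} {m : X ⊗ X ⟶ X} (h : IsAlgebra e m) :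
    IsAlgebra (X := (J).obj X) ((J).map e) ((J).map m) where
  one_mul := by
    have := congrArg (J).map h.one_mul
    simp only [Functor.map_comp, toFullImage_whiskerRight] at this
    exact this
  mul_one := by
    have := congrArg (J).map h.mul_one
    simp only [Functor.map_comp, toFullImage_whiskerLeft] at this
    exact this
  mul_assoc := by
    have := congrArg (J).map h.mul_assoc
    simp only [Functor.map_comp, toFullImage_whiskerRight, toFullImage_whiskerLeft] at this
    exact this

theorem μ_comp_conj {X Y X' Y' Z : C} (t : F.obj X ⊗ F.obj Y ⟶ F.obj X' ⊗ F.obj Y')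
    (s : F.obj (X' ⊗ Y') ⟶ F.obj Z) :
    Functor.LaxMonoidal.μ F X Y ≫ (Functor.OplaxMonoidal.δ F X Y ≫ t ≫
      Functor.LaxMonoidal.μ F X' Y') ≫ s = t ≫ Functor.LaxMonoidal.μ F X' Y' ≫ s := by
  simp only [Category.assoc, Functor.Monoidal.μ_δ_assoc]

theorem μ_comp_whiskerRight_hom {X Y : FullImage F} (f : X ⟶ Y) {Z W : C}
    (g : Y.toC ⊗ Z ⟶ W) :
    Functor.LaxMonoidal.μ F X.toC Z ≫ (f ▷ (J).obj Z ≫ (J).map g).hom =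
      f.hom ▷ F.obj Z ≫ Functor.LaxMonoidal.μ F Y.toC Z ≫ F.map g :=
  μ_comp_conj F (f.hom ▷ F.obj Z) (F.map g)

/-- An isomorphism in the full image that respects units and multiplications is an isomorphism of
algebras in `D`. -/
def mapMonIso {A B : Mon C} (G : (J).obj A.X ≅ (J).obj B.X)
    (one : (J).map η[A.X] ≫ G.hom = (J).map η[B.X])
    (mul : (J).map μ[A.X] ≫ G.hom = (G.hom ⊗ₘ G.hom) ≫ (J).map μ[B.X]) :
    F.mapMon.obj A ≅ F.mapMon.obj B :=
  Mon.mkIso ((inducedFunctor F.obj).mapIso G)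
    ((Category.assoc _ _ _).trans
      (congrArg (Functor.LaxMonoidal.ε F ≫ ·) (congrArg InducedCategory.Hom.hom one)))
    (by
      have h : F.map μ[A.X] ≫ G.hom.hom = (Functor.OplaxMonoidal.δ F A.X A.X ≫
          (G.hom.hom ⊗ₘ G.hom.hom) ≫ Functor.LaxMonoidal.μ F B.X B.X) ≫ F.map μ[B.X] :=
        congrArg InducedCategory.Hom.hom mul
      exact (Category.assoc _ _ _).trans
        ((congrArg (Functor.LaxMonoidal.μ F A.X A.X ≫ ·) h).trans (μ_comp_conj F _ _)))

/-- If both directions of the isomorphism come from `C`, then so does the isomorphism of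
algebras. -/
theorem exists_mapIso_eq_mapMonIso [F.Faithful] {A B : Mon C} (G : (J).obj A.X ≅ (J).obj B.X)
    (one : (J).map η[A.X] ≫ G.hom = (J).map η[B.X])
    (mul : (J).map μ[A.X] ≫ G.hom = (G.hom ⊗ₘ G.hom) ≫ (J).map μ[B.X])
    {g : A.X ⟶ B.X} {g' : B.X ⟶ A.X} (hg : (J).map g = G.hom) (hg' : (J).map g' = G.inv) :
    ∃ φ : A ≅ B, F.mapMon.mapIso φ = mapMonIso F G one mul := by
  have hJ {X Y : C} {a b : X ⟶ Y} (h : (J).map a = (J).map b) : a = b :=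
    F.map_injective (congrArg InducedCategory.Hom.hom h)
  refine ⟨Mon.mkIso ⟨g, g', hJ ?_, hJ ?_⟩ (hJ ?_) (hJ ?_), ?_⟩
  · rw [Functor.map_comp, hg, hg', G.hom_inv_id, CategoryTheory.Functor.map_id]
  · rw [Functor.map_comp, hg, hg', G.inv_hom_id, CategoryTheory.Functor.map_id]
  · rw [Functor.map_comp, hg, one]
  · simp only [Functor.map_comp, hg, toFullImage_tensorHom]
    exact mul
  · ext
    have h : F.map g = G.hom.hom := congrArg InducedCategory.Hom.hom hg
    exact h

end FullImage

/-! ### The morphism `λ̄ ρ(id ⊗ η)` -/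

section CRL

variable {C : Type u} [Category.{v} C] [MonoidalCategory C] [BraidedCategory C]
  {D : Type u'} [Category.{v'} D] [MonoidalCategory D] {F : C ⥤ D} [F.Monoidal]
  {H K : C} [HopfObj H] [HopfObj K] {ev : K ⊗ H ⟶ 𝟙_ C}

namespace CRL

theorem mono_lam (c : CRL F H K ev) : Mono c.lam := by
  have : Mono c.img.F.e := (SplitMono.mk c.lamBar c.lamBar_lam).mono
  rw [← c.img.F.fac]
  infer_instance

/-- Since `λ` is itself a monomorphism, it is its own image, and `λ̄` is inverse to the
corestriction of `λ`. -/
theorem lamBar_comp_lam (c : CRL F H K ev) : c.lamBar ≫ c.lam = c.img.F.m := by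
  have := c.mono_lam
  let G : Limits.MonoFactorisation c.lam := { I := F.obj (H ⊗ K), m := c.lam, e := 𝟙 _ }
  have h1 : c.img.isImage.lift G ≫ c.lam = c.img.F.m := c.img.isImage.lift_fac G
  have h2 : c.img.isImage.lift G ≫ c.img.F.e = 𝟙 _ := by
    rw [← cancel_mono c.img.F.m, Category.assoc, c.img.F.fac, h1, Category.id_comp]
  have h3 : c.img.isImage.lift G = c.lamBar := by
    rw [← Category.comp_id (c.img.isImage.lift G), ← c.lamBar_lam, reassoc_of% h2]
  rw [← h3, h1]

theorem lamBarRho_comp_lam (c : CRL F H K ev) :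
    c.lamBarRho ≫ c.lam = F.map ((ρ_ K).inv ≫ K ◁ η[H]) ≫ c.rho := by
  rw [lamBarRho, Category.assoc, c.lamBar_comp_lam, c.rhoFac_fac]

/-- Under the action `λ`, the morphism `λ̄ ρ(id ⊗ η)` becomes the action `rightHit`. -/
theorem lamBarRho_lamAct (c : CRL F H K ev) :
    c.lamBarRho ▷ F.obj H ≫ Functor.LaxMonoidal.μ F (H ⊗ K) H ≫ F.map (lamAct H K ev) =
      Functor.LaxMonoidal.μ F K H ≫ F.map (rightHit ev) := by
  rw [← c.lam_val, ← comp_whiskerRight_assoc, c.lamBarRho_comp_lam, comp_whiskerRight_assoc,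
    c.rho_val, Functor.LaxMonoidal.μ_natural_left_assoc, ← F.map_comp, rhoAct_one]

/-- The action `lamAct` of `H # K` on `H` is faithful. -/
theorem eq_of_lamAct (c : CRL F H K ev) {U : C} {a b : F.obj U ⟶ F.obj (H ⊗ K)}
    (h : a ▷ F.obj H ≫ Functor.LaxMonoidal.μ F (H ⊗ K) H ≫ F.map (lamAct H K ev) =
      b ▷ F.obj H ≫ Functor.LaxMonoidal.μ F (H ⊗ K) H ≫ F.map (lamAct H K ev)) : a = b := by
  have := c.mono_lam
  rw [← c.lam_val, ← comp_whiskerRight_assoc, ← comp_whiskerRight_assoc] at h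
  exact (cancel_mono c.lam).1 (c.val_injective _ _ h)

/-- The braiding with `R` is natural for `λ̄ ρ(id ⊗ η)`: it is natural for `λ` and `ρ`, and
`R ⊗ λ` is a monomorphism. -/
theorem lamBarRho_braiding (c : CRL F H K ev) (R : C) [Mono (F.obj R ◁ c.img.F.m)] :
    c.lamBarRho ▷ F.obj R ≫ Functor.LaxMonoidal.μ F (H ⊗ K) R ≫ F.map (β_ (H ⊗ K) R).hom =
      Functor.LaxMonoidal.μ F K R ≫ F.map (β_ K R).hom ≫ Functor.OplaxMonoidal.δ F R K ≫
        F.obj R ◁ c.lamBarRho ≫ Functor.LaxMonoidal.μ F R (H ⊗ K) := by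
  have h1 : Mono (F.obj R ◁ c.img.F.e) :=
    (SplitMono.mk (F.obj R ◁ c.lamBar)
      (by rw [← whiskerLeft_comp, c.lamBar_lam, whiskerLeft_id])).mono
  have h2 : Mono (F.obj R ◁ c.lam) := by
    rw [← c.img.F.fac, whiskerLeft_comp]
    infer_instance
  rw [← cancel_mono (Functor.OplaxMonoidal.δ F R (H ⊗ K)), ← cancel_mono (F.obj R ◁ c.lam),
    ← cancel_mono (Functor.LaxMonoidal.μ F R c.E)]
  simp only [Category.assoc]
  rw [← c.lam_braiding R, ← comp_whiskerRight_assoc, c.lamBarRho_comp_lam,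
    comp_whiskerRight_assoc, c.rho_braiding R, Functor.LaxMonoidal.μ_natural_left_assoc,
    ← F.map_comp_assoc, BraidedCategory.braiding_naturality_left, F.map_comp_assoc,
    Functor.Monoidal.μ_δ_assoc, ← whiskerLeft_comp_assoc, c.lamBarRho_comp_lam,
    whiskerLeft_comp_assoc, Functor.OplaxMonoidal.δ_natural_right_assoc]

end CRL

/-! ### Untwisting the iterated smash product -/

local notation "J" => toFullImage F

/-- `λ̄ ρ(id ⊗ η)` as a morphism of the full image of `F`. -/
def CRL.lamBarRhoHom (c : CRL F H K ev) : (J).obj K ⟶ (J).obj (H ⊗ K) :=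
  InducedCategory.homMk c.lamBarRho

variable {R : C} [MonObj R] {ψ : R ⟶ R ⊗ K}

/-- The interchange `iterTwist` is untwisted by `λ̄ ρ(id ⊗ η)`. The identities that involve this
morphism hold because they hold for the actions on `H`, the action of `H # K` being faithful; all
others are identities in `C`. -/
theorem CRL.innerTwist (c : CRL F H K ev) (h : IsQuasiDual H K ev) (hs : IsSymmetricOn H K)
    (hψ : IsComoduleAlgebra K ψ) [Mono (F.obj R ◁ c.img.F.m)] :
    InnerTwist (R := (J).obj R) (K := (J).obj K) (B := (J).obj (H ⊗ K)) ((J).map η[R])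
      ((J).map μ[R]) ((J).map (smashOne K η[H])) ((J).map (smashMulHK H K ev)) ((J).map η[K])
      ((J).map μ[K]) ((J).map ε[K]) ((J).map Δ[K]) ((J).map ψ) ((J).map (β_ K R).hom)
      ((J).map (β_ (H ⊗ K) R).hom) ((J).map (β_ K K).hom) ((J).map (β_ (H ⊗ K) K).hom)
      ((J).map (hitPast ev)) c.lamBarRhoHom ((J).map (iterTwist ev ψ)) := by
  have hκ : c.lamBarRhoHom ▷ (J).obj H ≫ (J).map (lamAct H K ev) = (J).map (rightHit ev) := by
    refine InducedCategory.hom_ext ((cancel_epi (Functor.LaxMonoidal.μ F K H)).1 ?_)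
    exact (μ_comp_whiskerRight_hom F c.lamBarRhoHom _).trans c.lamBarRho_lamAct
  have hβ : c.lamBarRhoHom ▷ (J).obj R ≫ (J).map (β_ (H ⊗ K) R).hom =
      (J).map (β_ K R).hom ≫ (J).obj R ◁ c.lamBarRhoHom := by
    refine InducedCategory.hom_ext ((cancel_epi (Functor.LaxMonoidal.μ F K R)).1 ?_)
    exact (μ_comp_whiskerRight_hom F c.lamBarRhoHom _).trans (c.lamBarRho_braiding R)
  have hf {U : FullImage F} (a b : U ⟶ (J).obj (H ⊗ K))
      (hab : a ▷ (J).obj H ≫ (J).map (lamAct H K ev) =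
        b ▷ (J).obj H ≫ (J).map (lamAct H K ev)) : a = b := by
    have := congrArg (fun t => Functor.LaxMonoidal.μ F U.toC H ≫ InducedCategory.Hom.hom t) hab
    exact InducedCategory.hom_ext (c.eq_of_lamAct (U := U.toC)
      ((μ_comp_whiskerRight_hom F a _).symm.trans (this.trans (μ_comp_whiskerRight_hom F b _))))
  have hmul (Z : FullImage F) := congrArg (J).map (op_smash_lamAct h Z.toC)
  simp only [Functor.map_comp, toFullImage_whiskerLeft, toFullImage_op21] at hmul
  exact
  { algB := IsAlgebra.toFullImage F (hit_isModuleAlgebra h).smash_isAlgebra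
    counit := fun Z => by
      have := congrArg (J).map (op_coact_counit hψ.counit Z.toC)
      simp only [Functor.map_comp, toFullImage_whiskerLeft, toFullImage_op12,
        toFullImage_op10] at this
      exact this.trans ((J).map_id _)
    coassoc := fun Z => by
      have := congrArg (J).map (op_coassoc hψ.coassoc Z.toC)
      simp only [Functor.map_comp, toFullImage_whiskerLeft, toFullImage_op12] at this
      exact this
    coact_mul := fun Z => by
      have := congrArg (J).map (op_comod_mul hψ.isComodAlg Z.toC)
      simp only [Functor.map_comp, toFullImage_whiskerLeft, toFullImage_op12, toFullImage_op21,
        toFullImage_op22] at this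
      exact this
    coact_one := fun Z => by
      have := congrArg (J).map (op_comod_one hψ.isComodAlg Z.toC)
      simp only [Functor.map_comp, toFullImage_op12, toFullImage_op01] at this
      exact this
    braid_B := fun Z => by
      have := congrArg (J).map (braid12_right ψ (H ⊗ K) Z.toC).symm
      simp only [Functor.map_comp, toFullImage_whiskerLeft, toFullImage_op12,
        toFullImage_op22] at this
      exact this
    braid_K := fun Z => by
      have := congrArg (J).map (braid12_right ψ K Z.toC).symm
      simp only [Functor.map_comp, toFullImage_whiskerLeft, toFullImage_op12,
        toFullImage_op22] at this
      exact this
    braid_mul := fun Z => by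
      have := congrArg (J).map (braid21_left (smashMulHK H K ev) R Z.toC)
      simp only [Functor.map_comp, toFullImage_whiskerLeft, toFullImage_op21,
        toFullImage_op22] at this
      exact this
    braid_κ := op_whisker_braid hβ
    braid_symm := fun Z => by
      have := congrArg (J).map (braid_cancel hs.right_right Z.toC)
      simp only [Functor.map_comp, toFullImage_op22] at this
      exact this.trans ((J).map_id _)
    κ_one := by
      refine op_factor_one hf hκ (fun Z => ?_) (fun Z => ?_)
      · have := congrArg (J).map (op_one_rightHit h Z.toC)
        simp only [Functor.map_comp, toFullImage_op01, toFullImage_op21] at this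
        exact this.trans ((J).map_id _)
      · have := congrArg (J).map (op_one_lamAct h Z.toC)
        simp only [Functor.map_comp, toFullImage_op01, toFullImage_op21] at this
        exact this.trans ((J).map_id _)
    κ_mul := by
      refine op_factor_mul hf hκ (fun Z => ?_) hmul
      have := congrArg (J).map (op_mul_rightHit h hs Z.toC)
      simp only [Functor.map_comp, toFullImage_op22, toFullImage_op21,
        toFullImage_whiskerLeft] at this
      exact this
    κ_exchange := by
      refine op_factor_exchange hf hκ (fun Z => ?_) hmul
      have := congrArg (J).map (op_hitPast_lamAct h hs Z.toC)
      simp only [Functor.map_comp, toFullImage_op22, toFullImage_op21, toFullImage_op12,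
        toFullImage_whiskerLeft] at this
      exact this
    twist_eq := fun Z => by
      have := congrArg (J).map (op22_iterTwist ev ψ Z.toC)
      simp only [Functor.map_comp, toFullImage_whiskerLeft, toFullImage_op12, toFullImage_op21,
        toFullImage_op22] at this
      exact this }

variable (c : CRL F H K ev) (h : IsQuasiDual H K ev) (hs : IsSymmetricOn H K) [IsIso 𝒮[K]]
  (hψ : IsComoduleAlgebra K ψ) [Mono (F.obj R ◁ c.img.F.m)]

/-- The automorphism `r ⊗ b ↦ r₀ ⊗ κ(r₁) b` of `R ⊗ (H ⊗ K)`, where `κ = λ̄ ρ(id ⊗ η)`. The inverse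
replaces `κ` by `κ S⁻¹`. -/
noncomputable def CRL.dualityIso : (J).obj (R ⊗ (H ⊗ K)) ≅ (J).obj (R ⊗ (H ⊗ K)) where
  hom := dualityMap (R := (J).obj R) (B := (J).obj (H ⊗ K)) (K := (J).obj K)
    ((J).map (smashMulHK H K ev)) ((J).map ψ) c.lamBarRhoHom
  inv := dualityMap (R := (J).obj R) (B := (J).obj (H ⊗ K)) (K := (J).obj K)
    ((J).map (smashMulHK H K ev)) ((J).map ψ) ((J).map (inv 𝒮[K]) ≫ c.lamBarRhoHom)
  hom_inv_id := InnerTwist.dualityMap_comp_eq_id ((c.innerTwist h hs hψ).op_map_inv fun Z => by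
    have := congrArg (J).map (op_antipode_inv_comul hs.right_right Z.toC)
    simp only [Functor.map_comp, toFullImage_whiskerRight, toFullImage_op12, toFullImage_op10,
      toFullImage_op01, toFullImage_op21, toFullImage_op22] at this
    exact this)
  inv_hom_id := InnerTwist.dualityMap_comp_eq_id ((c.innerTwist h hs hψ).op_inv_map fun Z => by
    have := congrArg (J).map (op_comul_antipode_inv hs.right_right Z.toC)
    simp only [Functor.map_comp, toFullImage_whiskerLeft, toFullImage_whiskerRight,
      toFullImage_op12, toFullImage_op10, toFullImage_op01, toFullImage_op21,
      toFullImage_op22] at this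
    exact this)

theorem CRL.dualityIso_one :
    (J).map ((λ_ (𝟙_ C)).inv ≫ (η[R] ⊗ₘ smashOne K η[H])) ≫ (c.dualityIso h hs hψ).hom =
      (J).map ((λ_ (𝟙_ C)).inv ≫ (η[R] ⊗ₘ smashOne K η[H])) := by
  rw [Functor.map_comp, toFullImage_tensorHom]
  exact (c.innerTwist h hs hψ).map_one

theorem CRL.dualityIso_mul :
    (J).map (twistMul μ[R] (smashMulHK H K ev) (β_ (H ⊗ K) R).hom) ≫
        (c.dualityIso h hs hψ).hom =
      ((c.dualityIso h hs hψ).hom ⊗ₘ (c.dualityIso h hs hψ).hom) ≫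
        (J).map (twistMul μ[R] (smashMulHK H K ev) (iterTwist ev ψ)) := by
  have h1 := toFullImage_twistMul F μ[R] (smashMulHK H K ev) (β_ (H ⊗ K) R).hom
  have h2 := toFullImage_twistMul F μ[R] (smashMulHK H K ev) (iterTwist ev ψ)
  exact (congrArg (· ≫ _) h1).trans
    ((c.innerTwist h hs hψ).map_mul.trans (congrArg (_ ≫ ·) h2.symm))

/-- `CRL.dualityIso`, followed by reassociation to the object of `(R # H) # K`. -/
noncomputable def CRL.smashIso : (J).obj (R ⊗ (H ⊗ K)) ≅ (J).obj ((R ⊗ H) ⊗ K) :=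
  c.dualityIso h hs hψ ≪≫ (J).mapIso (α_ R H K).symm

theorem CRL.smashIso_one :
    (J).map ((λ_ (𝟙_ C)).inv ≫ (η[R] ⊗ₘ smashOne K η[H])) ≫ (c.smashIso h hs hψ).hom =
      (J).map (smashOne K (smashOne H η[R])) := by
  have h1 := c.dualityIso_one h hs hψ
  rw [smashIso, Iso.trans_hom, reassoc_of% h1, smashOne_smashOne]
  exact ((J).map_comp _ _).symm

theorem CRL.smashIso_mul :
    (J).map (twistMul μ[R] (smashMulHK H K ev) (β_ (H ⊗ K) R).hom) ≫ (c.smashIso h hs hψ).hom =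
      ((c.smashIso h hs hψ).hom ⊗ₘ (c.smashIso h hs hψ).hom) ≫
        (J).map (smashMulRHK H K ev ψ) := by
  have h1 := c.dualityIso_mul h hs hψ
  have h2 := congrArg (J).map (twistMul_iterTwist_associator_inv ev ψ)
  simp only [Functor.map_comp, toFullImage_tensorHom] at h2
  rw [smashIso, Iso.trans_hom, reassoc_of% h1, ← tensorHom_comp_tensorHom]
  exact (Category.assoc _ _ _).trans ((congrArg
    (((c.dualityIso h hs hψ).hom ⊗ₘ (c.dualityIso h hs hψ).hom) ≫ ·) h2).trans
      (Category.assoc _ _ _).symm)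

/-- If `λ̄ ρ(id ⊗ η)` is the image of a morphism `κ` of `C`, then so is `CRL.smashIso`. -/
theorem CRL.map_eq_smashIso_hom {κ : K ⟶ H ⊗ K} (hκ : F.map κ = c.lamBarRho) :
    (J).map (dualityMap (smashMulHK H K ev) ψ κ ≫ (α_ R H K).inv) =
      (c.smashIso h hs hψ).hom := by
  have hκ' : (J).map κ = c.lamBarRhoHom := InducedCategory.hom_ext hκ
  rw [Functor.map_comp, toFullImage_dualityMap, hκ']
  rfl

theorem CRL.map_eq_smashIso_inv {κ : K ⟶ H ⊗ K} (hκ : F.map κ = c.lamBarRho) :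
    (J).map ((α_ R H K).hom ≫ dualityMap (smashMulHK H K ev) ψ (inv 𝒮[K] ≫ κ)) =
      (c.smashIso h hs hψ).inv := by
  have hκ' : (J).map κ = c.lamBarRhoHom := InducedCategory.hom_ext hκ
  rw [Functor.map_comp, toFullImage_dualityMap, Functor.map_comp, hκ']
  rfl

end CRL

end BraidedDuality

theorem theorem1p8
    {C : Type u} [Category.{v} C] [MonoidalCategory C] [BraidedCategory C]
    {D : Type u'} [Category.{v'} D] [MonoidalCategory D]
    (F : C ⥤ D) [F.Monoidal] [F.Faithful]
    (H K : C) [HopfObj H] [HopfObj K] (ev : K ⊗ H ⟶ 𝟙_ C)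
    (hdual : BraidedDuality.IsQuasiDual H K ev)
    (hsymm : BraidedDuality.IsSymmetricOn H K)
    (hSH : IsIso 𝒮[H]) (hSK : IsIso 𝒮[K])
    (c : BraidedDuality.CRL F H K ev)
    (R : C) [MonObj R] (ψ : R ⟶ R ⊗ K) (hψ : BraidedDuality.IsComoduleAlgebra K ψ)
    (hmono : Mono (F.obj R ◁ c.img.F.m)) :
    BraidedDuality.IsModuleAlgebra K η[H] μ[H] (BraidedDuality.hit H K ev) ∧
    BraidedDuality.IsModuleAlgebra H η[R] μ[R] (BraidedDuality.coactionAct H K ev ψ) ∧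
    BraidedDuality.IsModuleAlgebra K (BraidedDuality.smashOne H η[R])
      (BraidedDuality.smashMulRH H K ev ψ) (BraidedDuality.hitRight H K ev R) ∧
    ∃ (hHK : BraidedDuality.IsAlgebra (BraidedDuality.smashOne K η[H])
          (BraidedDuality.smashMulHK H K ev))
      (hRHK : BraidedDuality.IsAlgebra
          (BraidedDuality.smashOne K (BraidedDuality.smashOne H η[R]))
          (BraidedDuality.smashMulRHK H K ev ψ))
      (Φ : F.mapMon.obj hRHK.toMon ≅ F.mapMon.obj (Mon.mk R ⊗ hHK.toMon)),
      ∀ κ : K ⟶ H ⊗ K, F.map κ = c.lamBarRho →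
        ∃ φ : hRHK.toMon ≅ Mon.mk R ⊗ hHK.toMon, F.mapMon.mapIso φ = Φ := by
  have hA := BraidedDuality.hit_isModuleAlgebra hdual
  have hR := BraidedDuality.coactionAct_isModuleAlgebra hdual hsymm hψ
  have hRH := BraidedDuality.hitRight_isModuleAlgebra hdual hsymm hψ
  have hHK := hA.smash_isAlgebra
  have hRHK := hRH.smash_isAlgebra
  have one := c.smashIso_one hdual hsymm hψ
  have mul : (BraidedDuality.toFullImage F).map μ[(Mon.mk R ⊗ hHK.toMon).X] ≫
      (c.smashIso hdual hsymm hψ).hom =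
      ((c.smashIso hdual hsymm hψ).hom ⊗ₘ (c.smashIso hdual hsymm hψ).hom) ≫
        (BraidedDuality.toFullImage F).map (BraidedDuality.smashMulRHK H K ev ψ) := by
    rw [BraidedDuality.tensor_mul_eq_twistMul]
    exact c.smashIso_mul hdual hsymm hψ
  refine ⟨hA, hR, hRH, hHK, hRHK, (BraidedDuality.mapMonIso F (A := Mon.mk R ⊗ hHK.toMon)
    (B := hRHK.toMon) (c.smashIso hdual hsymm hψ) one mul).symm, fun κ hκ => ?_⟩
  obtain ⟨φ, hφ⟩ := BraidedDuality.exists_mapIso_eq_mapMonIso F (A := Mon.mk R ⊗ hHK.toMon)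
    (B := hRHK.toMon) (c.smashIso hdual hsymm hψ) one mul
    (c.map_eq_smashIso_hom hdual hsymm hψ hκ) (c.map_eq_smashIso_inv hdual hsymm hψ hκ)
  exact ⟨φ.symm, by rw [Functor.mapIso_symm, hφ]⟩
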